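/- Let $H_I,H_O$ be finite-dimensional nonzero Hilbert spaces with fixed orthonormal bases, let $p$ be a prior probability distribution on $\mathbb R$ with finite mean, and let $\mathcal E_\theta$ ($\theta\in\mathbb R$) be quantum channels from $H_I$ to $H_O$ depending measurably on $\theta$. Two copies of $\mathcal E_\theta$ are available ($N=2$), with inputs $H_{I_1},H_{I_2}\cong H_I$ and outputs $H_{O_1},H_{O_2}\cong H_O$. Put $H_{IO}=H_{I_1}\otimes H_{O_1}\otimes H_{I_2}\otimes H_{O_2}$ and $d_O=\dim(H_{O_1}\otimes H_{O_2})$. Let $C_\theta$ be the Choi operator of $\mathcal E_\theta\otimes\mathcal E_\theta$ on $H_{IO}$, and put $\bar C=\int C_\theta\,dp(\theta)$, $\overline{\theta C}=\int\theta\,C_\theta\,dp(\theta)$. Let $H$ be a Hermitian operator with $-(H\bar C+\bar CH)=\overline{\theta C}$, and let $\Phi$ be any matrix with $q$ columns such that $\Phi\Phi^\dagger=\bar C$. For a subsystem $Q$ write ${}_Q X=\operatorname{tr}_Q X\otimes \mathbb I_Q/d_Q$, and put $$\Lambda^{(1\prec2)}(X)={}_{O_2}X-{}_{I_2O_2}X+{}_{O_1I_2O_2}X,\qquad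 \Lambda^{(2\prec1)}(X)={}_{O_1}X-{}_{I_1O_1}X+{}_{O_2I_1O_1}X .$$ Let $\tilde{\mathbb X}^{(iii)}$ be the set of all $t\tilde X^{(1\prec2)}+(1-t)\tilde X^{(2\prec1)}$ with $0\le t\le1$, where $\tilde X^{(1\prec2)},\tilde X^{(2\prec1)}\ge0$ have trace $d_O$ and are fixed points of $\Lambda^{(1\prec2)}$ and $\Lambda^{(2\prec1)}$ respectively. A type-$iii$ strategy (superposition of causal orders) is an operator $X\ge0$ on $H_{IO}\otimes H_F$, with $H_F$ of any finite dimension, such that $\operatorname{tr}_FX\in\tilde{\mathbb X}^{(iii)}$. Its output states are $\rho_\theta=\operatorname{tr}_{IO}[X(C_\theta^T\otimes\mathbb I_F)]$, and the information gained with it is $\mathcal J=\operatorname{tr}(\bar\rho S^2)$, where $\bar\rho=\int\rho_\theta\,dp(\theta)$ and $S$ is a Hermitian solution of $\int\theta\rho_\theta\,dp(\theta)=\tfrac12(\bar\rho S+S\bar\rho)$. Let $\mathcal J_{\max}^{(iii)}$ be the maximum of $\mathcal J$ over all type-$iii$ strategies. For Hermitian $q\times q$ matrices $h$ put $\Omega(h)=4(H^*\Phi^*-i\Phi^*h)(H^*\Phi^*-i\Phi^*h)^\dagger$,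 where $^*$ is entrywise complex conjugation. Then this maximum is attained, $\mathcal J_{\max}^{(iii)}=\max_{\tilde X\in\tilde{\mathbb X}^{(iii)}}\min_{h=h^\dagger}\operatorname{tr}[\tilde X\Omega(h)]$, and $\mathcal J_{\max}^{(iii)}$ is equal to the optimal value, which is attained, of each of the following two semidefinite programs. Primal: $$\begin{aligned}\max_{\tilde X_1,\tilde X_2,B,C}\quad&-\operatorname{tr}C-4\operatorname{Re}[\operatorname{tr}(H^*\Phi^*B)]\\ \text{s.t.}\quad&\tilde X_1\ge0,\ \tilde X_2\ge0,\quad \Lambda^{(1\prec2)}(\tilde X_1)=\tilde X_1,\ \Lambda^{(2\prec1)}(\tilde X_2)=\tilde X_2,\quad \operatorname{tr}\tilde X_1+\operatorname{tr}\tilde X_2=d_O,\\ &\begin{bmatrix}\tilde X_1+\tilde X_2&B^\dagger\\B&C\end{bmatrix}\ge0,\qquad B\Phi^*\text{ is Hermitian.}\end{aligned}$$ Dual: $$\begin{aligned}\min_{h=h^\dagger,\ \lambda\in\mathbb R,\ \tilde Y_1,\tilde Y_2}\quad&\lambda\\ \text{s.t.}\quad&\Lambda^{(1\prec2)}(\tilde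 Y_1)=0,\quad\Lambda^{(2\prec1)}(\tilde Y_2)=0,\\ &\begin{bmatrix}\lambda\frac{\mathbb I_{IO}}{d_O}+\tilde Y_j&2(H^*\Phi^*-i\Phi^*h)\\2(H^*\Phi^*-i\Phi^*h)^\dagger&\mathbb I_q\end{bmatrix}\ge0\qquad(j=1,2).\end{aligned}$$ -/

import Mathlib

open scoped Matrix Kronecker ComplexOrder

namespace GlobalEst

noncomputable section

/-! ### Channels, prior averages and Choi operators -/

/-- A quantum channel: a completely positive, trace-preserving linear map on matrices. Complete
positivity says that `id_n ⊗ E` preserves positive semidefiniteness for every `n`. -/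
structure IsChannel {I O : Type*} [Fintype I] [Fintype O]
    (E : Matrix I I ℂ →ₗ[ℂ] Matrix O O ℂ) : Prop where
  completelyPositive : ∀ (n : ℕ) (M : Matrix (Fin n × I) (Fin n × I) ℂ), M.PosSemidef →
    (Matrix.of fun a b : Fin n × O =>
      E (Matrix.of fun i j : I => M (a.1, i) (b.1, j)) a.2 b.2).PosSemidef
  tracePreserving : ∀ ρ : Matrix I I ℂ, (E ρ).trace = ρ.trace

/-- The Choi operator `∑ |i⟩⟨j| ⊗ E(|i⟩⟨j|)` on `H_I ⊗ H_O`. -/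
def choi {I O : Type*} [DecidableEq I]
    (E : Matrix I I ℂ →ₗ[ℂ] Matrix O O ℂ) : Matrix (I × O) (I × O) ℂ :=
  Matrix.of fun a b => E (Matrix.single a.1 b.1 1) a.2 b.2

/-- The index set of `H_{I₁} ⊗ H_{O₁} ⊗ H_{I₂} ⊗ H_{O₂}`; the two channels are copies of each
other, so `I₁`, `I₂` are both `I` and `O₁`, `O₂` are both `O`. -/
abbrev Sys (I O : Type*) := (I × O) × (I × O)

/-- The Choi operator of the two copies of the channel. -/
def choi₂ {I O : Type*} [DecidableEq I]
    (E : Matrix I I ℂ →ₗ[ℂ] Matrix O O ℂ) : Matrix (Sys I O) (Sys I O) ℂ :=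
  choi E ⊗ₖ choi E

/-- The entrywise average of a matrix-valued function over the prior `p`. -/
def average {m : Type*} (p : MeasureTheory.Measure ℝ) (f : ℝ → Matrix m m ℂ) : Matrix m m ℂ :=
  Matrix.of fun a b => ∫ θ, f θ a b ∂p

/-- `C̄ = ∫ p(θ) C_θ dθ`, where `C_θ` is the Choi operator of the two copies of `E_θ`. -/
def meanChoi {I O : Type*} [DecidableEq I]
    (p : MeasureTheory.Measure ℝ) (E : ℝ → Matrix I I ℂ →ₗ[ℂ] Matrix O O ℂ) :
    Matrix (Sys I O) (Sys I O) ℂ :=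
  average p fun θ => choi₂ (E θ)

/-- `∫ p(θ) θ C_θ dθ`. -/
def meanThetaChoi {I O : Type*} [DecidableEq I]
    (p : MeasureTheory.Measure ℝ) (E : ℝ → Matrix I I ℂ →ₗ[ℂ] Matrix O O ℂ) :
    Matrix (Sys I O) (Sys I O) ℂ :=
  average p fun θ => (θ : ℂ) • choi₂ (E θ)

/-! ### Strategies -/

/-- Partial trace over the second factor. -/
def traceRight {m F : Type*} [Fintype F] (X : Matrix (m × F) (m × F) ℂ) : Matrix m m ℂ :=
  Matrix.of fun a b => ∑ f, X (a, f) (b, f)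

/-- Partial trace over the first factor. -/
def traceLeft {m F : Type*} [Fintype m] (X : Matrix (m × F) (m × F) ℂ) : Matrix F F ℂ :=
  Matrix.of fun f g => ∑ a, X (a, f) (a, g)

/-- The link product `X ⋆ C = tr_{IO} [X (Cᵀ ⊗ 𝕀_F)]`. -/
def link {m F : Type*} [Fintype m] [Fintype F] [DecidableEq F]
    (X : Matrix (m × F) (m × F) ℂ) (C : Matrix m m ℂ) : Matrix F F ℂ :=
  traceLeft (X * (Cᵀ ⊗ₖ (1 : Matrix F F ℂ)))

/-- Trace out `O₁` and replace it by the normalized identity. -/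
def replO₁ {I O : Type*} [Fintype O] [DecidableEq O]
    (M : Matrix (Sys I O) (Sys I O) ℂ) : Matrix (Sys I O) (Sys I O) ℂ :=
  Matrix.of fun a b => if a.1.2 = b.1.2 then
    (∑ o, M ((a.1.1, o), a.2) ((b.1.1, o), b.2)) / (Fintype.card O : ℂ) else 0

/-- Trace out `I₁` and replace it by the normalized identity. -/
def replI₁ {I O : Type*} [Fintype I] [DecidableEq I]
    (M : Matrix (Sys I O) (Sys I O) ℂ) : Matrix (Sys I O) (Sys I O) ℂ :=
  Matrix.of fun a b => if a.1.1 = b.1.1 then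
    (∑ i, M ((i, a.1.2), a.2) ((i, b.1.2), b.2)) / (Fintype.card I : ℂ) else 0

/-- Trace out `O₂` and replace it by the normalized identity. -/
def replO₂ {I O : Type*} [Fintype O] [DecidableEq O]
    (M : Matrix (Sys I O) (Sys I O) ℂ) : Matrix (Sys I O) (Sys I O) ℂ :=
  Matrix.of fun a b => if a.2.2 = b.2.2 then
    (∑ o, M (a.1, (a.2.1, o)) (b.1, (b.2.1, o))) / (Fintype.card O : ℂ) else 0

/-- Trace out `I₂` and replace it by the normalized identity. -/
def replI₂ {I O : Type*} [Fintype I] [DecidableEq I]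
    (M : Matrix (Sys I O) (Sys I O) ℂ) : Matrix (Sys I O) (Sys I O) ℂ :=
  Matrix.of fun a b => if a.2.1 = b.2.1 then
    (∑ i, M (a.1, (i, a.2.2)) (b.1, (i, b.2.2))) / (Fintype.card I : ℂ) else 0

section Strategies

variable {I O : Type*} [Fintype I] [DecidableEq I] [Fintype O] [DecidableEq O]

/-- `Λ^(1≺2)(X) = _{O₂}X - _{I₂O₂}X + _{O₁I₂O₂}X`. -/
def Lam₁₂ (X : Matrix (Sys I O) (Sys I O) ℂ) : Matrix (Sys I O) (Sys I O) ℂ :=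
  replO₂ X - replI₂ (replO₂ X) + replO₁ (replI₂ (replO₂ X))

/-- `Λ^(2≺1)(X) = _{O₁}X - _{I₁O₁}X + _{O₂I₁O₁}X`. -/
def Lam₂₁ (X : Matrix (Sys I O) (Sys I O) ℂ) : Matrix (Sys I O) (Sys I O) ℂ :=
  replO₁ X - replI₁ (replO₁ X) + replO₂ (replI₁ (replO₁ X))

variable (I O) in
/-- The operators `X̃^(1≺2)` of sequential strategies of causal order `1 ≺ 2`; `(card O)²` is the
dimension `d_O` of `H_{O₁} ⊗ H_{O₂}`. -/
def seq₁₂ : Set (Matrix (Sys I O) (Sys I O) ℂ) :=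
  {X | X.PosSemidef ∧ Lam₁₂ X = X ∧ X.trace = (Fintype.card O : ℂ) ^ 2}

variable (I O) in
/-- The operators `X̃^(2≺1)` of sequential strategies of causal order `2 ≺ 1`. -/
def seq₂₁ : Set (Matrix (Sys I O) (Sys I O) ℂ) :=
  {X | X.PosSemidef ∧ Lam₂₁ X = X ∧ X.trace = (Fintype.card O : ℂ) ^ 2}

variable (I O) in
/-- The set `𝕏̃^(iii)` of convex combinations of operators `X̃^(1≺2)` and `X̃^(2≺1)`. -/
def redStrategies : Set (Matrix (Sys I O) (Sys I O) ℂ) :=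
  {X | ∃ t : ℝ, 0 ≤ t ∧ t ≤ 1 ∧ ∃ X₁ ∈ seq₁₂ I O, ∃ X₂ ∈ seq₂₁ I O,
    X = (t : ℂ) • X₁ + ((1 - t : ℝ) : ℂ) • X₂}

variable (I O) in
/-- The type-iii strategies with output space `H_F = ℂ^d`: positive semidefinite operators `X` on
`H_{IO} ⊗ H_F` whose reduction `X̃ = tr_F X` lies in `𝕏̃^(iii)`. -/
def strategies (d : ℕ) : Set (Matrix (Sys I O × Fin d) (Sys I O × Fin d) ℂ) :=
  {X | X.PosSemidef ∧ traceRight X ∈ redStrategies I O}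

/-! ### The information gained in a Bayesian estimation -/

/-- `ρ̄ = ∫ p(θ) ρ_θ dθ` for the output states `ρ_θ = X ⋆ C_θ` of the strategy `X`. -/
def meanState (p : MeasureTheory.Measure ℝ) (E : ℝ → Matrix I I ℂ →ₗ[ℂ] Matrix O O ℂ)
    {d : ℕ} (X : Matrix (Sys I O × Fin d) (Sys I O × Fin d) ℂ) : Matrix (Fin d) (Fin d) ℂ :=
  average p fun θ => link X (choi₂ (E θ))

/-- `∫ p(θ) θ ρ_θ dθ` for the output states `ρ_θ = X ⋆ C_θ` of the strategy `X`. -/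
def meanThetaState (p : MeasureTheory.Measure ℝ) (E : ℝ → Matrix I I ℂ →ₗ[ℂ] Matrix O O ℂ)
    {d : ℕ} (X : Matrix (Sys I O × Fin d) (Sys I O × Fin d) ℂ) : Matrix (Fin d) (Fin d) ℂ :=
  average p fun θ => (θ : ℂ) • link X (choi₂ (E θ))

/-- `j` is the information `tr (ρ̄ S²)` gained with the strategy `X`, where `S` is a Hermitian
solution of `∫ p(θ) θ ρ_θ dθ = (ρ̄ S + S ρ̄) / 2`. (The value does not depend on the choice of `S`.) -/
def IsInformation (p : MeasureTheory.Measure ℝ) (E : ℝ → Matrix I I ℂ →ₗ[ℂ] Matrix O O ℂ)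
    {d : ℕ} (X : Matrix (Sys I O × Fin d) (Sys I O × Fin d) ℂ) (j : ℝ) : Prop :=
  ∃ S : Matrix (Fin d) (Fin d) ℂ, S.IsHermitian ∧
    meanThetaState p E X = (1 / 2 : ℂ) • (meanState p E X * S + S * meanState p E X) ∧
    j = (meanState p E X * S ^ 2).trace.re

/-- The amounts of information gained with type-iii strategies, with output spaces of arbitrary
finite dimension. -/
def informationValues (p : MeasureTheory.Measure ℝ)
    (E : ℝ → Matrix I I ℂ →ₗ[ℂ] Matrix O O ℂ) : Set ℝ :=
  {j | ∃ (d : ℕ), ∃ X ∈ strategies I O d, IsInformation p E X j}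

/-- `J_max^(iii)`. -/
def Jmax (p : MeasureTheory.Measure ℝ) (E : ℝ → Matrix I I ℂ →ₗ[ℂ] Matrix O O ℂ) : ℝ :=
  sSup (informationValues p E)

/-! ### The optimization problems -/

/-- Entrywise complex conjugation. -/
def conj {m n : Type*} (M : Matrix m n ℂ) : Matrix m n ℂ := M.map (starRingEnd ℂ)

/-- `H* Φ* - i Φ* h`. -/
def gap {q : ℕ} (H : Matrix (Sys I O) (Sys I O) ℂ) (Φ : Matrix (Sys I O) (Fin q) ℂ)
    (h : Matrix (Fin q) (Fin q) ℂ) : Matrix (Sys I O) (Fin q) ℂ :=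
  conj H * conj Φ - Complex.I • (conj Φ * h)

/-- `Ω(h) = 4 (H* Φ* - i Φ* h) (H* Φ* - i Φ* h)†`. -/
def Omega {q : ℕ} (H : Matrix (Sys I O) (Sys I O) ℂ) (Φ : Matrix (Sys I O) (Fin q) ℂ)
    (h : Matrix (Fin q) (Fin q) ℂ) : Matrix (Sys I O) (Sys I O) ℂ :=
  (4 : ℂ) • (gap H Φ h * (gap H Φ h)ᴴ)

/-- The values over which the maximum is taken in `max_{X̃ ∈ 𝕏̃^(iii)} min_h tr [X̃ Ω(h)]`. -/
def maxMinValues {q : ℕ} (H : Matrix (Sys I O) (Sys I O) ℂ) (Φ : Matrix (Sys I O) (Fin q) ℂ) :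
    Set ℝ :=
  {v | ∃ X ∈ redStrategies I O,
    IsLeast {w | ∃ h : Matrix (Fin q) (Fin q) ℂ, h.IsHermitian ∧
      w = (X * Omega H Φ h).trace.re} v}

/-- The objective values at feasible points of the primal semidefinite program. -/
def primalValues {q : ℕ} (H : Matrix (Sys I O) (Sys I O) ℂ) (Φ : Matrix (Sys I O) (Fin q) ℂ) :
    Set ℝ :=
  {v | ∃ (X₁ X₂ : Matrix (Sys I O) (Sys I O) ℂ) (B : Matrix (Fin q) (Sys I O) ℂ)
      (C : Matrix (Fin q) (Fin q) ℂ),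
    X₁.PosSemidef ∧ X₂.PosSemidef ∧ Lam₁₂ X₁ = X₁ ∧ Lam₂₁ X₂ = X₂ ∧
    X₁.trace + X₂.trace = (Fintype.card O : ℂ) ^ 2 ∧
    (Matrix.fromBlocks (X₁ + X₂) Bᴴ B C).PosSemidef ∧
    (B * conj Φ).IsHermitian ∧
    v = -C.trace.re - 4 * (conj H * conj Φ * B).trace.re}

/-- The objective values at feasible points of the dual semidefinite program. -/
def dualValues {q : ℕ} (H : Matrix (Sys I O) (Sys I O) ℂ) (Φ : Matrix (Sys I O) (Fin q) ℂ) :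
    Set ℝ :=
  {l | ∃ (h : Matrix (Fin q) (Fin q) ℂ) (Y₁ Y₂ : Matrix (Sys I O) (Sys I O) ℂ),
    h.IsHermitian ∧ Lam₁₂ Y₁ = 0 ∧ Lam₂₁ Y₂ = 0 ∧
    (Matrix.fromBlocks (((l : ℂ) / (Fintype.card O : ℂ) ^ 2) • 1 + Y₁)
      ((2 : ℂ) • gap H Φ h) ((2 : ℂ) • gap H Φ h)ᴴ 1).PosSemidef ∧
    (Matrix.fromBlocks (((l : ℂ) / (Fintype.card O : ℂ) ^ 2) • 1 + Y₂)
      ((2 : ℂ) • gap H Φ h) ((2 : ℂ) • gap H Φ h)ᴴ 1).PosSemidef}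

end Strategies

end

end GlobalEst

/-! Positivity of the Choi operators forces the kernel of the mean Choi operator to be killed by the
first moment as well. Hence `H * Φ = Φ * G` for some `G` (`exists_mul_eq_mul`), the gap equals `Φ*
(G* - i h)`, and for a fixed reduced strategy `X̃` the inner problem only involves the positive `q ×
q` matrix `R = (Φ*)† X̃ Φ*`. It is a convex quadratic problem in `h`, minimized wherever `R (G* - i
h)` is Hermitian; a Lyapunov equation provides such an `h`, even for singular `R`.

The four optimal values are linked by inclusions and inequalities, so no minimax theorem is invoked.
A stationary `h` produces a pure strategy and a Hermitian `S` whose information is the inner minimum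
(`maxMinValues_subset_informationValues`). Conversely, any strategy with its `S` yields a primal
feasible point of the same value (`informationValues_subset_primalValues`). A primal value is at
most `tr [X̃ Ω(h)]` for every Hermitian `h` (`primal_le_trace_mul_Omega`), hence at most the inner
minimum at its own `X̃`. That minimum is an upper semicontinuous function of `X̃` on a compact set,
so its maximum exists and the first three maxima coincide.

For the dual, the causal constraints enter through linear maps that are idempotent, self-adjoint for
the trace form and unital. Self-adjointness gives the lower bound on dual values
(`trace_mul_Omega_le`); unitality makes the identity a strictly feasible direction, so the Riesz
extension theorem turns an upper bound of the primal values into a dual feasible point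
(`mem_dualValues`). -/

namespace GlobalEst

/-! ### Matrix equations, trace inequalities and linear functionals -/

section LinearAlgebra

variable {m n k : Type*} [Fintype m] [Fintype n]

/-- Unitary diagonalization of a positive semidefinite matrix. -/
theorem exists_unitary_diagonalization [DecidableEq n] {R : Matrix n n ℂ} (hR : R.PosSemidef) :
    ∃ (U : Matrix n n ℂ) (l : n → ℝ), Uᴴ * U = 1 ∧ U * Uᴴ = 1 ∧ (∀ i, 0 ≤ l i) ∧
      Uᴴ * R * U = Matrix.diagonal fun i => (l i : ℂ) := by
  refine ⟨hR.1.eigenvectorUnitary, hR.1.eigenvalues, ?_, ?_, hR.eigenvalues_nonneg, ?_⟩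
  · exact Unitary.coe_star_mul_self _
  · exact Unitary.coe_mul_star_self _
  · have h := hR.1.spectral_theorem
    rw [Unitary.conjStarAlgAut_apply] at h
    have key : ∀ U L : Matrix n n ℂ, Uᴴ * U = 1 → R = U * L * Uᴴ → Uᴴ * R * U = L := by
      intro U L hU hRU
      calc Uᴴ * R * U = (Uᴴ * U) * L * (Uᴴ * U) := by rw [hRU]; simp only [Matrix.mul_assoc]
        _ = L := by rw [hU, one_mul, mul_one]
    exact key _ _ (Unitary.coe_star_mul_self _) h

/-- A Lyapunov equation that is solvable also for singular `R`. -/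
theorem exists_isHermitian_mul_add_mul {R : Matrix n n ℂ} (hR : R.PosSemidef)
    (G : Matrix n n ℂ) :
    ∃ h : Matrix n n ℂ, h.IsHermitian ∧ h * R + R * h = Complex.I • (Gᴴ * R - R * G) := by
  classical
  obtain ⟨U, l, hU, hU', hl, hd⟩ := exists_unitary_diagonalization hR
  have hR' : R = U * Matrix.diagonal (fun i => (l i : ℂ)) * Uᴴ := by
    rw [← hd]
    simp only [Matrix.mul_assoc, hU', mul_one]
    rw [← Matrix.mul_assoc, hU', one_mul]
  set D : Matrix n n ℂ := Matrix.diagonal (fun i => (l i : ℂ)) with hD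
  set G' := Uᴴ * G * U with hG'
  have hG : G = U * G' * Uᴴ := by
    rw [hG']
    simp only [Matrix.mul_assoc, hU', mul_one]
    rw [← Matrix.mul_assoc, hU', one_mul]
  -- In the eigenbasis the equation decouples into one scalar equation per entry, with coefficient
  -- `l i + l j`. If this sum is zero, both eigenvalues vanish and so does the right-hand side, so
  -- the value `0` of the division is a solution.
  set h' : Matrix n n ℂ := Matrix.of fun i j =>
    Complex.I * (star (G' j i) * l j - l i * G' i j) / (l i + l j) with hh'
  have h'herm : h'.IsHermitian := by
    ext i j
    simp only [hh', Matrix.conjTranspose_apply, Matrix.of_apply, star_div₀, star_mul', star_sub,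
      star_add, Complex.star_def, Complex.conj_ofReal, Complex.conj_I, add_comm (l i : ℂ)]
    congr 1
    simp only [Complex.conj_conj]
    ring
  have key : h' * D + D * h' = Complex.I • (G'ᴴ * D - D * G') := by
    ext i j
    simp only [hD, Matrix.add_apply, Matrix.mul_diagonal, Matrix.diagonal_mul, Matrix.smul_apply,
      Matrix.sub_apply, Matrix.conjTranspose_apply, smul_eq_mul, hh', Matrix.of_apply]
    by_cases h0 : l i + l j = 0
    · have hi : l i = 0 := by linarith [hl i, hl j]
      have hj : l j = 0 := by linarith [hl i, hl j]
      simp [hi, hj]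
    · have h0' : (l i + l j : ℂ) ≠ 0 := by exact_mod_cast h0
      field_simp
      ring
  refine ⟨U * h' * Uᴴ, ?_, ?_⟩
  · exact Matrix.isHermitian_mul_mul_conjTranspose _ h'herm
  · have e1 : U * h' * Uᴴ * R = U * (h' * D) * Uᴴ := by
      rw [hR']
      calc _ = U * h' * (Uᴴ * U) * D * Uᴴ := by simp only [Matrix.mul_assoc]
        _ = _ := by rw [hU, mul_one]; simp only [Matrix.mul_assoc]
    have e2 : R * (U * h' * Uᴴ) = U * (D * h') * Uᴴ := by
      rw [hR']
      calc _ = U * D * (Uᴴ * U) * h' * Uᴴ := by simp only [Matrix.mul_assoc]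
        _ = _ := by rw [hU, mul_one]; simp only [Matrix.mul_assoc]
    have e3 : Gᴴ * R = U * (G'ᴴ * D) * Uᴴ := by
      rw [hR', hG]
      simp only [Matrix.conjTranspose_mul, Matrix.conjTranspose_conjTranspose]
      calc _ = U * G'ᴴ * (Uᴴ * U) * D * Uᴴ := by simp only [Matrix.mul_assoc]
        _ = _ := by rw [hU, mul_one]; simp only [Matrix.mul_assoc]
    have e4 : R * G = U * (D * G') * Uᴴ := by
      rw [hR', hG]
      calc _ = U * D * (Uᴴ * U) * G' * Uᴴ := by simp only [Matrix.mul_assoc]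
        _ = _ := by rw [hU, mul_one]; simp only [Matrix.mul_assoc]
    rw [e1, e2, e3, e4, ← Matrix.add_mul, ← Matrix.mul_add, key, ← Matrix.sub_mul, ← Matrix.mul_sub,
      Matrix.mul_smul, Matrix.smul_mul]

/-- If `R N` is Hermitian, it factors as `R Z R` with `Z` Hermitian. -/
theorem exists_isHermitian_mul_mul {R N : Matrix n n ℂ} (hR : R.PosSemidef)
    (hN : (R * N).IsHermitian) :
    ∃ Z : Matrix n n ℂ, Z.IsHermitian ∧ R * Z * R = R * N := by
  classical
  obtain ⟨U, l, hU, hU', hl, hd⟩ := exists_unitary_diagonalization hR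
  have hR' : R = U * Matrix.diagonal (fun i => (l i : ℂ)) * Uᴴ := by
    rw [← hd]
    simp only [Matrix.mul_assoc, hU', mul_one]
    rw [← Matrix.mul_assoc, hU', one_mul]
  set D : Matrix n n ℂ := Matrix.diagonal (fun i => (l i : ℂ)) with hD
  set W := Uᴴ * (R * N) * U with hW
  have hWN : W = D * (Uᴴ * N * U) := by
    rw [hW, hR']
    calc _ = (Uᴴ * U) * D * (Uᴴ * N * U) := by simp only [Matrix.mul_assoc]
      _ = _ := by rw [hU, one_mul]
  have hWh : W.IsHermitian := Matrix.isHermitian_conjTranspose_mul_mul _ hN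
  -- The factor `D` kills the rows of `W` belonging to zero eigenvalues, and Hermiticity transfers
  -- this to the columns. Dividing by `l i * l j` therefore loses nothing.
  have hW0 : ∀ i j, l i = 0 → W i j = 0 := by
    intro i j hi
    rw [hWN, hD, Matrix.diagonal_mul, hi]; simp
  have hW0' : ∀ i j, l j = 0 → W i j = 0 := by
    intro i j hj
    rw [← hWh.apply, hW0 j i hj, star_zero]
  set Z : Matrix n n ℂ := Matrix.of fun i j => W i j / (l i * l j) with hZ
  have hZh : Z.IsHermitian := by
    ext i j
    simp only [hZ, Matrix.conjTranspose_apply, Matrix.of_apply, star_div₀, star_mul',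
      Complex.star_def, Complex.conj_ofReal]
    rw [← Complex.star_def, hWh.apply, mul_comm]
  have key : D * Z * D = W := by
    ext i j
    simp only [hD, Matrix.mul_diagonal, Matrix.diagonal_mul, hZ, Matrix.of_apply]
    by_cases hi : l i = 0
    · simp [hi, hW0 i j hi]
    by_cases hj : l j = 0
    · simp [hj, hW0' i j hj]
    have hi' : (l i : ℂ) ≠ 0 := by exact_mod_cast hi
    have hj' : (l j : ℂ) ≠ 0 := by exact_mod_cast hj
    field_simp
  refine ⟨U * Z * Uᴴ, Matrix.isHermitian_mul_mul_conjTranspose _ hZh, ?_⟩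
  calc R * (U * Z * Uᴴ) * R = U * D * (Uᴴ * U) * Z * (Uᴴ * U) * D * Uᴴ := by
        rw [hR']; simp only [Matrix.mul_assoc]
    _ = U * (D * Z * D) * Uᴴ := by rw [hU, mul_one, mul_one]; simp only [Matrix.mul_assoc]
    _ = (U * Uᴴ) * (R * N) * (U * Uᴴ) := by rw [key, hW]; simp only [Matrix.mul_assoc]
    _ = _ := by rw [hU', one_mul, mul_one]

/-- Entries of a positive semidefinite matrix are bounded by its trace. -/
theorem norm_apply_le_trace {X : Matrix n n ℂ} (hX : X.PosSemidef) (a b : n) :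
    ‖X a b‖ ≤ X.trace.re := by
  classical
  obtain ⟨r, v, rfl⟩ := Matrix.posSemidef_iff_eq_sum_vecMulVec.mp hX
  have h1 : ∀ i, ‖v i a * star (v i b)‖ ≤ ∑ c, ‖v i c‖ ^ 2 := by
    intro i
    rw [norm_mul, norm_star]
    rcases eq_or_ne a b with rfl | hab
    · rw [← sq]
      exact Finset.single_le_sum (f := fun c => ‖v i c‖ ^ 2) (fun c _ => sq_nonneg _)
        (Finset.mem_univ a)
    · have : ∑ c ∈ {a, b}, ‖v i c‖ ^ 2 ≤ ∑ c, ‖v i c‖ ^ 2 :=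
        Finset.sum_le_sum_of_subset_of_nonneg (Finset.subset_univ _) fun _ _ _ => sq_nonneg _
      rw [Finset.sum_pair hab] at this
      nlinarith [sq_nonneg (‖v i a‖ - ‖v i b‖), sq_nonneg (‖v i a‖), sq_nonneg (‖v i b‖)]
  calc ‖(∑ i, Matrix.vecMulVec (v i) (star (v i))) a b‖ = ‖∑ i, v i a * star (v i b)‖ := by
        simp [Matrix.sum_apply, Matrix.vecMulVec_apply]
    _ ≤ ∑ i, ‖v i a * star (v i b)‖ := norm_sum_le _ _
    _ ≤ ∑ i, ∑ c, ‖v i c‖ ^ 2 := Finset.sum_le_sum fun i _ => h1 i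
    _ = _ := by
        simp only [Matrix.trace_sum, Complex.re_sum]
        refine Finset.sum_congr rfl fun i _ => ?_
        simp only [Matrix.trace, Matrix.diag, Matrix.vecMulVec_apply, Complex.re_sum, Pi.star_apply]
        refine Finset.sum_congr rfl fun c _ => ?_
        rw [Complex.star_def, Complex.mul_conj, Complex.normSq_eq_norm_sq, Complex.ofReal_re]

theorem trace_mul_re_nonneg {X Y : Matrix n n ℂ} (hX : X.PosSemidef) (hY : Y.PosSemidef) :
    0 ≤ (X * Y).trace.re := by
  obtain ⟨r, v, rfl⟩ := Matrix.posSemidef_iff_eq_sum_vecMulVec.mp hY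
  rw [Matrix.mul_sum, Matrix.trace_sum, Complex.re_sum]
  refine Finset.sum_nonneg fun i _ => ?_
  rw [Matrix.mul_vecMulVec, Matrix.trace_vecMulVec, dotProduct_comm]
  exact (Complex.le_def.mp (hX.dotProduct_mulVec_nonneg (v i))).1

theorem re_trace_conjTranspose (X : Matrix n n ℂ) : Xᴴ.trace.re = X.trace.re := by
  rw [Matrix.trace_conjTranspose, Complex.star_def, Complex.conj_re]

/-- Real-linear functionals on complex matrices are real parts of traces. -/
theorem exists_eq_re_trace_mul (φ : Matrix m n ℂ →ₗ[ℝ] ℝ) :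
    ∃ Y : Matrix n m ℂ, ∀ X, φ X = (Y * X).trace.re := by
  classical
  -- The entries are chosen by `Re ((s - i t) (x + i y)) = s x + t y`, with `s`, `t` the values of
  -- `φ` at the real and imaginary unit in position `(a, b)`.
  refine ⟨Matrix.of fun b a => (φ (Matrix.single a b 1) : ℂ) -
    Complex.I * (φ (Matrix.single a b Complex.I) : ℂ), fun X => ?_⟩
  have h1 : ∀ a b, φ (Matrix.single a b (X a b)) =
      (((φ (Matrix.single a b 1) : ℂ) - Complex.I * (φ (Matrix.single a b Complex.I) : ℂ))
        * X a b).re := by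
    intro a b
    have : Matrix.single a b (X a b) = (X a b).re • Matrix.single a b (1 : ℂ) +
        (X a b).im • Matrix.single a b Complex.I := by
      simp only [Matrix.smul_single, ← Matrix.single_add]
      congr 1
      apply Complex.ext <;> simp
    rw [this, map_add, map_smul, map_smul]
    simp
    ring
  conv_lhs => rw [Matrix.matrix_eq_sum_single X]
  simp only [map_sum, h1, Matrix.trace, Matrix.diag, Matrix.mul_apply, Complex.re_sum,
    Matrix.of_apply]
  rw [Finset.sum_comm]

/-- A matrix whose kernel contains that of `A` factors through `A`. -/
theorem exists_mul_eq_of_ker_le (A : Matrix m n ℂ) (B : Matrix k n ℂ)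
    (hAB : ∀ v, A *ᵥ v = 0 → B *ᵥ v = 0) : ∃ G : Matrix k m ℂ, G * A = B := by
  classical
  have h : ∀ i : k, ∃ g : m → ℂ, g ᵥ* A = B i := by
    intro i
    -- Row `i` of `B`, seen as a functional, annihilates `ker A`, so it lies in the range of the
    -- dual map of `A`.
    have hmem : (LinearMap.proj i ∘ₗ B.mulVecLin : Module.Dual ℂ (n → ℂ)) ∈
        (LinearMap.ker A.mulVecLin).dualAnnihilator := by
      rw [Submodule.mem_dualAnnihilator]
      intro v hv
      have := hAB v (by simpa using hv)
      simp [this]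
    rw [← LinearMap.range_dualMap_eq_dualAnnihilator_ker] at hmem
    obtain ⟨f, hf⟩ := hmem
    refine ⟨fun a => f (Pi.single a 1), ?_⟩
    ext j
    have := LinearMap.congr_fun hf (Pi.single j 1)
    simp only [LinearMap.dualMap_apply, LinearMap.comp_apply, Matrix.mulVecLin_apply,
      LinearMap.proj_apply, Matrix.mulVec_single_one, Matrix.col_apply] at this
    rw [← this, LinearMap.pi_apply_eq_sum_univ f]
    simp only [Matrix.vecMul, dotProduct, Matrix.col_apply, smul_eq_mul]
    refine Finset.sum_congr rfl fun a _ => ?_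
    rw [mul_comm]
    congr 2
    ext c
    simp [Pi.single_apply, eq_comm]
  choose g hg using h
  refine ⟨Matrix.of g, ?_⟩
  ext i j
  rw [← hg i]; rfl

/-- The identity is an algebraic interior point of the cone of matrices with nonnegative real
quadratic form. -/
theorem exists_re_dotProduct_smul_one_add_nonneg [DecidableEq n] (Y : Matrix n n ℂ) :
    ∃ s : ℝ, 0 ≤ s ∧ ∀ r : ℝ, s ≤ r → ∀ u : n → ℂ,
      0 ≤ (star u ⬝ᵥ ((r : ℂ) • (1 : Matrix n n ℂ) + Y) *ᵥ u).re := by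
  -- The sum of the absolute values of the entries bounds the quadratic form of `Y` by a multiple of
  -- `‖u‖²`.
  refine ⟨∑ a, ∑ b, ‖Y a b‖, by positivity, fun r hr u => ?_⟩
  have hn : ∀ a, ‖u a‖ ^ 2 ≤ ∑ c, ‖u c‖ ^ 2 := fun a =>
    Finset.single_le_sum (f := fun c => ‖u c‖ ^ 2) (fun c _ => sq_nonneg _) (Finset.mem_univ a)
  have h1 : ‖star u ⬝ᵥ Y *ᵥ u‖ ≤ (∑ a, ∑ b, ‖Y a b‖) * ∑ c, ‖u c‖ ^ 2 := by
    rw [dotProduct, Finset.sum_mul]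
    refine (norm_sum_le _ _).trans (Finset.sum_le_sum fun a _ => ?_)
    rw [Matrix.mulVec, dotProduct, Finset.mul_sum, Finset.sum_mul]
    refine (norm_sum_le _ _).trans (Finset.sum_le_sum fun b _ => ?_)
    rw [norm_mul, norm_mul, Pi.star_apply, norm_star]
    have : ‖u a‖ * ‖u b‖ ≤ ∑ c, ‖u c‖ ^ 2 := by
      nlinarith [sq_nonneg (‖u a‖ - ‖u b‖), hn a, hn b]
    calc ‖u a‖ * (‖Y a b‖ * ‖u b‖) = ‖Y a b‖ * (‖u a‖ * ‖u b‖) := by ring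
      _ ≤ _ := by gcongr
  have h2 : (star u ⬝ᵥ u).re = ∑ c, ‖u c‖ ^ 2 := by
    simp only [dotProduct, Complex.re_sum, Pi.star_apply]
    refine Finset.sum_congr rfl fun c _ => ?_
    rw [Complex.star_def, mul_comm, Complex.mul_conj, Complex.normSq_eq_norm_sq, Complex.ofReal_re]
  have h3 : (star u ⬝ᵥ ((r : ℂ) • (1 : Matrix n n ℂ) + Y) *ᵥ u).re =
      r * ∑ c, ‖u c‖ ^ 2 + (star u ⬝ᵥ Y *ᵥ u).re := by
    rw [Matrix.add_mulVec, dotProduct_add, Matrix.smul_mulVec, Matrix.one_mulVec, dotProduct_smul,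
      Complex.add_re, smul_eq_mul, Complex.re_ofReal_mul, h2]
  have h4 := (abs_le.mp ((Complex.abs_re_le_norm _).trans h1)).1
  have h5 : (∑ a, ∑ b, ‖Y a b‖) * ∑ c, ‖u c‖ ^ 2 ≤ r * ∑ c, ‖u c‖ ^ 2 := by gcongr
  rw [h3]; linarith

end LinearAlgebra

/-! ### Tracing out a tensor factor and replacing it by the normalized identity -/

section Replacement

variable {N A B : Type*} [Fintype N] [Fintype A] [Fintype B] [DecidableEq B]

/-- Trace out the factor `B` of `N ≃ A × B` and replace it by the normalized identity. -/
noncomputable def repl (e : N ≃ A × B) : Module.End ℂ (Matrix N N ℂ) where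
  toFun M := Matrix.of fun a b => if (e a).2 = (e b).2 then
    (∑ c, M (e.symm ((e a).1, c)) (e.symm ((e b).1, c))) / (Fintype.card B : ℂ) else 0
  map_add' X Y := by
    ext a b
    simp only [Matrix.of_apply, Matrix.add_apply, Finset.sum_add_distrib, add_div]
    split_ifs <;> simp
  map_smul' c X := by
    ext a b
    simp only [Matrix.of_apply, Matrix.smul_apply, smul_eq_mul, ← Finset.mul_sum, mul_div_assoc,
      RingHom.id_apply]
    split_ifs <;> simp

omit [Fintype N] [Fintype A] in
theorem repl_apply (e : N ≃ A × B) (M : Matrix N N ℂ) (a b : N) :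
    repl e M a b = if (e a).2 = (e b).2 then
      (∑ c, M (e.symm ((e a).1, c)) (e.symm ((e b).1, c))) / (Fintype.card B : ℂ) else 0 := rfl

omit [Fintype N] [Fintype A] in
theorem repl_conjTranspose (e : N ≃ A × B) (M : Matrix N N ℂ) : repl e Mᴴ = (repl e M)ᴴ := by
  ext a b
  simp only [repl_apply, Matrix.conjTranspose_apply, eq_comm (a := (e b).2)]
  split_ifs <;> simp

omit [Fintype N] [Fintype A] in
theorem repl_idem [Nonempty B] (e : N ≃ A × B) : repl e * repl e = repl e := by
  refine LinearMap.ext fun M => ?_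
  ext a b
  have h : (Fintype.card B : ℂ) ≠ 0 := by simp
  simp only [Module.End.mul_apply, repl_apply, Equiv.apply_symm_apply, if_true, Finset.sum_const,
    Finset.card_univ, nsmul_eq_mul]
  split_ifs
  · field_simp
  · rfl

omit [Fintype N] [Fintype A] in
theorem repl_one [DecidableEq N] [Nonempty B] (e : N ≃ A × B) : repl e 1 = 1 := by
  ext a b
  have h : (Fintype.card B : ℂ) ≠ 0 := by simp
  simp only [repl_apply, Matrix.one_apply, EmbeddingLike.apply_eq_iff_eq, Prod.mk.injEq, and_true]
  by_cases hab : a = b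
  · simp [hab, h]
  · have : ¬ ((e a).2 = (e b).2 ∧ (e a).1 = (e b).1) := fun h =>
      hab (e.injective (Prod.ext h.2 h.1))
    rw [if_neg hab]
    by_cases h1 : (e a).2 = (e b).2
    · simpa [h1] using this
    · rw [if_neg h1]

/-- Both sides equal the trace of `tr_B X * tr_B Y` divided by `dim B`. This is self-adjointness for
the bilinear form `tr (X Y)`, without conjugation. -/
theorem trace_repl_mul (e : N ≃ A × B) (X Y : Matrix N N ℂ) :
    (repl e X * Y).trace = (X * repl e Y).trace := by
  simp only [Matrix.trace, Matrix.diag, Matrix.mul_apply]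
  simp only [← e.symm.sum_comp, Fintype.sum_prod_type, repl_apply, Equiv.apply_symm_apply, ite_mul,
    zero_mul, mul_ite, mul_zero, Finset.sum_ite_eq, Finset.mem_univ, if_true]
  refine Finset.sum_congr rfl fun a _ => ?_
  rw [Finset.sum_comm, Finset.sum_comm (s := (Finset.univ : Finset B))]
  refine Finset.sum_congr rfl fun b _ => ?_
  simp only [Finset.sum_div, Finset.sum_mul, Finset.mul_sum]
  rw [Finset.sum_comm]
  simp only [mul_div_assoc, div_mul_eq_mul_div, Finset.sum_ite_eq', Finset.mem_univ, if_true]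

end Replacement

/-! ### The causal-order maps as self-adjoint unital projections -/

section Lam

/-- A combination of commuting idempotents that is idempotent. -/
theorem idem_of_commuting_idem {R : Type*} [Ring R] {a b c : R} (ha : a * a = a) (hb : b * b = b)
    (hc : c * c = c) (hab : a * b = b * a) (hac : a * c = c * a) (hbc : b * c = c * b) :
    (a - b * a + c * (b * a)) * (a - b * a + c * (b * a)) = a - b * a + c * (b * a) := by
  have h1 : b * a * (b * a) = b * a := by
    rw [mul_assoc, ← mul_assoc a, hab, mul_assoc, ha, ← mul_assoc, hb]
  have h2 : a * (b * a) = b * a := by rw [← mul_assoc, hab, mul_assoc, ha]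
  have h3 : b * a * a = b * a := by rw [mul_assoc, ha]
  have h4 : b * a * c = c * (b * a) := by rw [mul_assoc, hac, ← mul_assoc, hbc, mul_assoc]
  have h5 : a * (c * (b * a)) = c * (b * a) := by rw [← mul_assoc, hac, mul_assoc, h2]
  have h6 : b * a * (c * (b * a)) = c * (b * a) := by rw [← mul_assoc, h4, mul_assoc, h1]
  have h7 : c * (b * a) * (c * (b * a)) = c * (b * a) := by
    rw [mul_assoc, h6, ← mul_assoc, hc]
  have h8 : c * (b * a) * a = c * (b * a) := by rw [mul_assoc, h3]
  have h9 : c * (b * a) * (b * a) = c * (b * a) := by rw [mul_assoc, h1]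
  simp only [add_mul, sub_mul, mul_add, mul_sub, ha, h1, h2, h3, h5, h6, h7, h8, h9]
  abel

variable {I O : Type*}

/-- Single out `O₁`. -/
def equivO₁ : Sys I O ≃ (I × (I × O)) × O where
  toFun a := ((a.1.1, a.2), a.1.2)
  invFun a := ((a.1.1, a.2), a.1.2)

/-- Single out `O₂`. -/
def equivO₂ : Sys I O ≃ ((I × O) × I) × O where
  toFun a := ((a.1, a.2.1), a.2.2)
  invFun a := (a.1.1, (a.1.2, a.2))

/-- Single out `I₁`. -/
def equivI₁ : Sys I O ≃ (O × (I × O)) × I where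
  toFun a := ((a.1.2, a.2), a.1.1)
  invFun a := ((a.2, a.1.1), a.1.2)

/-- Single out `I₂`. -/
def equivI₂ : Sys I O ≃ ((I × O) × O) × I where
  toFun a := ((a.1, a.2.2), a.2.1)
  invFun a := (a.1.1, (a.2, a.1.2))

variable [Fintype I] [DecidableEq I] [Fintype O] [DecidableEq O]

-- Replacements on distinct tensor factors commute because finite sums may be interchanged. This and
-- the next four lemmas cover exactly the pairs of factors that occur together in one of the two
-- causal-order maps.
omit [Fintype I] [DecidableEq I] in
theorem replO₁_comm_replO₂ :
    (repl equivO₁ * repl equivO₂ : Module.End ℂ (Matrix (Sys I O) (Sys I O) ℂ)) =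
      repl equivO₂ * repl equivO₁ := by
  refine LinearMap.ext fun M => ?_
  ext a b
  simp only [Module.End.mul_apply, repl_apply, equivO₁, equivO₂, Equiv.coe_fn_mk,
    Equiv.coe_fn_symm_mk]
  split_ifs
  · simp only [← Finset.sum_div]; rw [Finset.sum_comm]
  all_goals simp

theorem replO₁_comm_replI₂ :
    (repl equivO₁ * repl equivI₂ : Module.End ℂ (Matrix (Sys I O) (Sys I O) ℂ)) =
      repl equivI₂ * repl equivO₁ := by
  refine LinearMap.ext fun M => ?_
  ext a b
  simp only [Module.End.mul_apply, repl_apply, equivO₁, equivI₂, Equiv.coe_fn_mk,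
    Equiv.coe_fn_symm_mk]
  split_ifs
  · simp only [← Finset.sum_div]; rw [Finset.sum_comm, div_right_comm]
  all_goals simp

theorem replO₂_comm_replI₂ :
    (repl equivO₂ * repl equivI₂ : Module.End ℂ (Matrix (Sys I O) (Sys I O) ℂ)) =
      repl equivI₂ * repl equivO₂ := by
  refine LinearMap.ext fun M => ?_
  ext a b
  simp only [Module.End.mul_apply, repl_apply, equivO₂, equivI₂, Equiv.coe_fn_mk,
    Equiv.coe_fn_symm_mk]
  split_ifs
  · simp only [← Finset.sum_div]; rw [Finset.sum_comm, div_right_comm]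
  all_goals simp

theorem replO₂_comm_replI₁ :
    (repl equivO₂ * repl equivI₁ : Module.End ℂ (Matrix (Sys I O) (Sys I O) ℂ)) =
      repl equivI₁ * repl equivO₂ := by
  refine LinearMap.ext fun M => ?_
  ext a b
  simp only [Module.End.mul_apply, repl_apply, equivO₂, equivI₁, Equiv.coe_fn_mk,
    Equiv.coe_fn_symm_mk]
  split_ifs
  · simp only [← Finset.sum_div]; rw [Finset.sum_comm, div_right_comm]
  all_goals simp

theorem replO₁_comm_replI₁ :
    (repl equivO₁ * repl equivI₁ : Module.End ℂ (Matrix (Sys I O) (Sys I O) ℂ)) =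
      repl equivI₁ * repl equivO₁ := by
  refine LinearMap.ext fun M => ?_
  ext a b
  simp only [Module.End.mul_apply, repl_apply, equivO₁, equivI₁, Equiv.coe_fn_mk,
    Equiv.coe_fn_symm_mk]
  split_ifs
  · simp only [← Finset.sum_div]; rw [Finset.sum_comm, div_right_comm]
  all_goals simp

variable (I O) in
/-- `Lam₁₂` as a linear map. -/
noncomputable def lam₁₂ : Module.End ℂ (Matrix (Sys I O) (Sys I O) ℂ) :=
  repl equivO₂ - repl equivI₂ * repl equivO₂ + repl equivO₁ * (repl equivI₂ * repl equivO₂)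

variable (I O) in
/-- `Lam₂₁` as a linear map. -/
noncomputable def lam₂₁ : Module.End ℂ (Matrix (Sys I O) (Sys I O) ℂ) :=
  repl equivO₁ - repl equivI₁ * repl equivO₁ + repl equivO₂ * (repl equivI₁ * repl equivO₁)

theorem Lam₁₂_eq (X : Matrix (Sys I O) (Sys I O) ℂ) : Lam₁₂ X = lam₁₂ I O X := rfl

theorem Lam₂₁_eq (X : Matrix (Sys I O) (Sys I O) ℂ) : Lam₂₁ X = lam₂₁ I O X := rfl

/-- The properties of the projections `Lam₁₂` and `Lam₂₁` on which the duality theory rests. -/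
structure IsCausalProjection {N : Type*} [Fintype N] [DecidableEq N]
    (L : Module.End ℂ (Matrix N N ℂ)) : Prop where
  idem : ∀ X, L (L X) = L X
  map_conjTranspose : ∀ X, L Xᴴ = (L X)ᴴ
  trace_mul : ∀ X Y, (L X * Y).trace = (X * L Y).trace
  map_one : L 1 = 1

/-- With the commuting idempotents `a`, `b`, `c` for `O₂`, `I₂`, `O₁`, the map is `a (1 - b (1 -
c))`, a product of two commuting idempotents. -/
theorem lam₁₂_mul_self [Nonempty I] [Nonempty O] : lam₁₂ I O * lam₁₂ I O = lam₁₂ I O := by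
  unfold lam₁₂
  exact idem_of_commuting_idem (repl_idem _) (repl_idem _) (repl_idem _)
    replO₂_comm_replI₂ replO₁_comm_replO₂.symm replO₁_comm_replI₂.symm

theorem isCausalProjection_lam₁₂ [Nonempty I] [Nonempty O] : IsCausalProjection (lam₁₂ I O) where
  idem X := by rw [← Module.End.mul_apply, lam₁₂_mul_self]
  map_conjTranspose X := by
    simp only [lam₁₂, LinearMap.add_apply, LinearMap.sub_apply, Module.End.mul_apply,
      repl_conjTranspose, Matrix.conjTranspose_add, Matrix.conjTranspose_sub]
  trace_mul X Y := by
    -- Passing a composite to the other side of the trace reverses the order of its factors; the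
    -- commutation relations restore it.
    have h1 : ∀ Z : Matrix (Sys I O) (Sys I O) ℂ, repl equivO₁ (repl equivO₂ Z) =
        repl equivO₂ (repl equivO₁ Z) := fun Z => by
      rw [← Module.End.mul_apply, replO₁_comm_replO₂, Module.End.mul_apply]
    have h2 : ∀ Z : Matrix (Sys I O) (Sys I O) ℂ, repl equivO₁ (repl equivI₂ Z) =
        repl equivI₂ (repl equivO₁ Z) := fun Z => by
      rw [← Module.End.mul_apply, replO₁_comm_replI₂, Module.End.mul_apply]
    have h3 : ∀ Z : Matrix (Sys I O) (Sys I O) ℂ, repl equivO₂ (repl equivI₂ Z) =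
        repl equivI₂ (repl equivO₂ Z) := fun Z => by
      rw [← Module.End.mul_apply, replO₂_comm_replI₂, Module.End.mul_apply]
    simp only [lam₁₂, LinearMap.add_apply, LinearMap.sub_apply, Module.End.mul_apply, add_mul,
      sub_mul, mul_add, mul_sub, Matrix.trace_add, Matrix.trace_sub, trace_repl_mul, h1, h2, h3]
  map_one := by
    simp only [lam₁₂, LinearMap.add_apply, LinearMap.sub_apply, Module.End.mul_apply, repl_one,
      sub_self, zero_add]

theorem lam₂₁_mul_self [Nonempty I] [Nonempty O] : lam₂₁ I O * lam₂₁ I O = lam₂₁ I O := by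
  unfold lam₂₁
  exact idem_of_commuting_idem (repl_idem _) (repl_idem _) (repl_idem _)
    replO₁_comm_replI₁ replO₁_comm_replO₂ replO₂_comm_replI₁.symm

theorem isCausalProjection_lam₂₁ [Nonempty I] [Nonempty O] : IsCausalProjection (lam₂₁ I O) where
  idem X := by rw [← Module.End.mul_apply, lam₂₁_mul_self]
  map_conjTranspose X := by
    simp only [lam₂₁, LinearMap.add_apply, LinearMap.sub_apply, Module.End.mul_apply,
      repl_conjTranspose, Matrix.conjTranspose_add, Matrix.conjTranspose_sub]
  trace_mul X Y := by
    have h1 : ∀ Z : Matrix (Sys I O) (Sys I O) ℂ, repl equivO₁ (repl equivO₂ Z) =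
        repl equivO₂ (repl equivO₁ Z) := fun Z => by
      rw [← Module.End.mul_apply, replO₁_comm_replO₂, Module.End.mul_apply]
    have h2 : ∀ Z : Matrix (Sys I O) (Sys I O) ℂ, repl equivO₁ (repl equivI₁ Z) =
        repl equivI₁ (repl equivO₁ Z) := fun Z => by
      rw [← Module.End.mul_apply, replO₁_comm_replI₁, Module.End.mul_apply]
    have h3 : ∀ Z : Matrix (Sys I O) (Sys I O) ℂ, repl equivO₂ (repl equivI₁ Z) =
        repl equivI₁ (repl equivO₂ Z) := fun Z => by
      rw [← Module.End.mul_apply, replO₂_comm_replI₁, Module.End.mul_apply]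
    simp only [lam₂₁, LinearMap.add_apply, LinearMap.sub_apply, Module.End.mul_apply, add_mul,
      sub_mul, mul_add, mul_sub, Matrix.trace_add, Matrix.trace_sub, trace_repl_mul, h1, h2, h3]
  map_one := by
    simp only [lam₂₁, LinearMap.add_apply, LinearMap.sub_apply, Module.End.mul_apply, repl_one,
      sub_self, zero_add]

end Lam

/-! ### Choi operators, their prior averages and the invariance of the range of `Φ` -/

section Choi

open MeasureTheory

variable {I O : Type*} [Fintype I] [DecidableEq I] [Fintype O]

/-- The Choi operator is the image under `id ⊗ E` of the rank-one matrix of the unnormalized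
maximally entangled vector `w`. Complete positivity is formulated with ancillas `Fin n`, hence the
reindexing by `e`. -/
theorem IsChannel.choi_posSemidef {E : Matrix I I ℂ →ₗ[ℂ] Matrix O O ℂ} (hE : IsChannel E) :
    (choi E).PosSemidef := by
  let e := Fintype.equivFin I
  let w : Fin (Fintype.card I) × I → ℂ := fun a => if a.2 = e.symm a.1 then 1 else 0
  have h := hE.completelyPositive (Fintype.card I) (Matrix.vecMulVec w (star w))
    (Matrix.posSemidef_vecMulVec_self_star w)
  have h2 := h.submatrix (fun a : I × O => (e a.1, a.2))
  convert h2 using 1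
  ext a b
  simp only [choi, Matrix.of_apply, Matrix.submatrix_apply]
  refine congrArg (fun M => E M a.2 b.2) ?_
  ext i j
  simp only [Matrix.single_apply, Matrix.vecMulVec_apply, Matrix.of_apply, Pi.star_apply, w,
    Equiv.symm_apply_apply, eq_comm (a := i), eq_comm (a := j)]
  split_ifs <;> simp_all

theorem IsChannel.choi_trace {E : Matrix I I ℂ →ₗ[ℂ] Matrix O O ℂ} (hE : IsChannel E) :
    (choi E).trace = Fintype.card I := by
  have h : ∀ i : I, ∑ o, E (Matrix.single i i 1) o o = 1 := fun i => by
    have := hE.tracePreserving (Matrix.single i i 1)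
    rw [Matrix.trace_single_eq_same] at this
    exact this
  simp only [Matrix.trace, Matrix.diag, choi, Matrix.of_apply, Fintype.sum_prod_type, h]
  simp

theorem IsChannel.choi₂_posSemidef {E : Matrix I I ℂ →ₗ[ℂ] Matrix O O ℂ} (hE : IsChannel E) :
    (choi₂ E).PosSemidef :=
  hE.choi_posSemidef.kronecker hE.choi_posSemidef

/-- Entries of a positive matrix are bounded by its trace, here `dim I` for each factor. The bound
is uniform in `θ`, so every average over the prior converges as soon as the prior has a mean. -/
theorem IsChannel.norm_choi₂_le {E : Matrix I I ℂ →ₗ[ℂ] Matrix O O ℂ} (hE : IsChannel E)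
    (a b : Sys I O) : ‖choi₂ E a b‖ ≤ (Fintype.card I : ℝ) ^ 2 := by
  have h : ∀ a b : I × O, ‖choi E a b‖ ≤ Fintype.card I := fun a b => by
    simpa [hE.choi_trace] using norm_apply_le_trace hE.choi_posSemidef a b
  rw [choi₂, Matrix.kroneckerMap_apply, norm_mul, sq]
  exact mul_le_mul (h _ _) (h _ _) (norm_nonneg _) (Nat.cast_nonneg _)

variable {p : Measure ℝ} {E : ℝ → Matrix I I ℂ →ₗ[ℂ] Matrix O O ℂ}

theorem integrable_choi₂ [IsProbabilityMeasure p] (hE : ∀ θ, IsChannel (E θ))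
    (hEm : ∀ (ρ : Matrix I I ℂ) (a b : O), AEMeasurable (fun θ => E θ ρ a b) p) (a b : Sys I O) :
    Integrable (fun θ => choi₂ (E θ) a b) p := by
  refine Integrable.of_bound (C := (Fintype.card I : ℝ) ^ 2) ?_
    (Filter.Eventually.of_forall fun θ => (hE θ).norm_choi₂_le a b)
  exact ((hEm _ _ _).mul (hEm _ _ _)).aestronglyMeasurable

theorem integrable_smul_choi₂ [IsProbabilityMeasure p] (hp : Integrable (fun θ : ℝ => θ) p)
    (hE : ∀ θ, IsChannel (E θ))
    (hEm : ∀ (ρ : Matrix I I ℂ) (a b : O), AEMeasurable (fun θ => E θ ρ a b) p) (a b : Sys I O) :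
    Integrable (fun θ : ℝ => ((θ : ℂ) • choi₂ (E θ)) a b) p := by
  simp only [Matrix.smul_apply, smul_eq_mul]
  refine Integrable.mul_bdd (c := (Fintype.card I : ℝ) ^ 2) hp.ofReal
    (integrable_choi₂ hE hEm a b).aestronglyMeasurable
    (Filter.Eventually.of_forall fun θ => (hE θ).norm_choi₂_le a b)

theorem average_mulVec {m : Type*} [Fintype m] {f : ℝ → Matrix m m ℂ}
    (hf : ∀ a b, Integrable (fun θ => f θ a b) p) (v : m → ℂ) (a : m) :
    (average p f *ᵥ v) a = ∫ θ, (f θ *ᵥ v) a ∂p := by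
  simp only [Matrix.mulVec, dotProduct, average, Matrix.of_apply]
  rw [integral_finsetSum _ fun b _ => (hf a b).mul_const _]
  simp only [integral_mul_const]

/-- The kernel of the mean Choi operator annihilates almost all Choi operators, hence also the
first moment. -/
theorem meanThetaChoi_mulVec_eq_zero [IsProbabilityMeasure p]
    (hp : Integrable (fun θ : ℝ => θ) p) (hE : ∀ θ, IsChannel (E θ))
    (hEm : ∀ (ρ : Matrix I I ℂ) (a b : O), AEMeasurable (fun θ => E θ ρ a b) p)
    {v : Sys I O → ℂ} (hv : meanChoi p E *ᵥ v = 0) : meanThetaChoi p E *ᵥ v = 0 := by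
  have hint := integrable_choi₂ hE hEm
  have hmv : ∀ a, Integrable (fun θ => (choi₂ (E θ) *ᵥ v) a) p := fun a =>
    integrable_finsetSum _ fun b _ => (hint a b).mul_const _
  have hq : Integrable (fun θ => star v ⬝ᵥ (choi₂ (E θ) *ᵥ v)) p :=
    integrable_finsetSum _ fun a _ => (hmv a).const_mul _
  have h0 : ∫ θ, star v ⬝ᵥ (choi₂ (E θ) *ᵥ v) ∂p = 0 := by
    simp only [dotProduct]
    rw [integral_finsetSum _ fun a _ => (hmv a).const_mul _]
    refine Finset.sum_eq_zero fun a _ => ?_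
    rw [integral_const_mul, ← average_mulVec hint]
    have : (average p fun θ => choi₂ (E θ)) *ᵥ v = 0 := hv
    simp [this]
  have hre : ∫ θ, (star v ⬝ᵥ (choi₂ (E θ) *ᵥ v)).re ∂p = 0 := by
    have h := integral_re (𝕜 := ℂ) hq
    simp only [RCLike.re_to_complex] at h
    rw [h, h0, Complex.zero_re]
  have hnn : ∀ θ, 0 ≤ star v ⬝ᵥ (choi₂ (E θ) *ᵥ v) := fun θ =>
    (hE θ).choi₂_posSemidef.dotProduct_mulVec_nonneg v
  rw [integral_eq_zero_iff_of_nonneg (fun θ => (Complex.le_def.mp (hnn θ)).1) hq.re] at hre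
  -- A nonnegative integrand with zero integral vanishes almost everywhere, and a positive matrix
  -- whose quadratic form vanishes at `v` kills `v`.
  have hae : ∀ᵐ θ ∂p, choi₂ (E θ) *ᵥ v = 0 := by
    filter_upwards [hre] with θ hθ
    rw [← (hE θ).choi₂_posSemidef.dotProduct_mulVec_zero_iff]
    exact Complex.ext hθ (Complex.le_def.mp (hnn θ)).2.symm
  ext a
  rw [meanThetaChoi, average_mulVec (integrable_smul_choi₂ hp hE hEm)]
  rw [integral_congr_ae (g := fun _ => (0 : ℂ))]
  · simp
  · filter_upwards [hae] with θ hθ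
    rw [Matrix.smul_mulVec, hθ]; simp

theorem link_apply {m F : Type*} [Fintype m] [Fintype F] [DecidableEq F]
    (X : Matrix (m × F) (m × F) ℂ) (C : Matrix m m ℂ) (f g : F) :
    link X C f g = ∑ a, ∑ b, X (a, f) (b, g) * C a b := by
  simp only [link, traceLeft, Matrix.of_apply, Matrix.mul_apply, Fintype.sum_prod_type,
    Matrix.kroneckerMap_apply, Matrix.transpose_apply, Matrix.one_apply, mul_ite, mul_one, mul_zero,
    Finset.sum_ite_eq', Finset.mem_univ, if_true]

theorem average_link {m F : Type*} [Fintype m] [Fintype F] [DecidableEq F]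
    (X : Matrix (m × F) (m × F) ℂ) {f : ℝ → Matrix m m ℂ}
    (hf : ∀ a b, Integrable (fun θ => f θ a b) p) :
    average p (fun θ => link X (f θ)) = link X (average p f) := by
  ext i j
  simp only [average, Matrix.of_apply, link_apply]
  rw [integral_finsetSum _ fun a _ => integrable_finsetSum _ fun b _ => (hf a b).const_mul _]
  refine Finset.sum_congr rfl fun a _ => ?_
  rw [integral_finsetSum _ fun b _ => (hf a b).const_mul _]
  simp only [integral_const_mul]

theorem link_smul {m F : Type*} [Fintype m] [Fintype F] [DecidableEq F]
    (X : Matrix (m × F) (m × F) ℂ) (c : ℂ) (C : Matrix m m ℂ) : link X (c • C) = c • link X C := by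
  rw [link, Matrix.transpose_smul, Matrix.smul_kronecker, Matrix.mul_smul]
  ext i j
  simp [traceLeft, link, Finset.mul_sum]


theorem meanState_eq [IsProbabilityMeasure p] (hE : ∀ θ, IsChannel (E θ))
    (hEm : ∀ (ρ : Matrix I I ℂ) (a b : O), AEMeasurable (fun θ => E θ ρ a b) p) {d : ℕ}
    (X : Matrix (Sys I O × Fin d) (Sys I O × Fin d) ℂ) :
    meanState p E X = link X (meanChoi p E) :=
  average_link X (integrable_choi₂ hE hEm)

theorem meanThetaState_eq [IsProbabilityMeasure p] (hp : Integrable (fun θ : ℝ => θ) p)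
    (hE : ∀ θ, IsChannel (E θ))
    (hEm : ∀ (ρ : Matrix I I ℂ) (a b : O), AEMeasurable (fun θ => E θ ρ a b) p) {d : ℕ}
    (X : Matrix (Sys I O × Fin d) (Sys I O × Fin d) ℂ) :
    meanThetaState p E X = link X (meanThetaChoi p E) := by
  simp only [meanThetaState, ← link_smul]
  exact average_link X (integrable_smul_choi₂ hp hE hEm)

/-- `H` maps the range of `Φ` into itself. -/
theorem exists_mul_eq_mul [IsProbabilityMeasure p]
    (hp : Integrable (fun θ : ℝ => θ) p) (hE : ∀ θ, IsChannel (E θ))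
    (hEm : ∀ (ρ : Matrix I I ℂ) (a b : O), AEMeasurable (fun θ => E θ ρ a b) p)
    {H : Matrix (Sys I O) (Sys I O) ℂ} (hH : H.IsHermitian)
    (hHC : -(H * meanChoi p E + meanChoi p E * H) = meanThetaChoi p E)
    {q : ℕ} {Φ : Matrix (Sys I O) (Fin q) ℂ} (hΦ : Φ * Φᴴ = meanChoi p E) :
    ∃ G : Matrix (Fin q) (Fin q) ℂ, H * Φ = Φ * G := by
  -- If `Φᴴ v = 0`, then the mean Choi operator and hence also the first moment kill `v`. The
  -- equation for `H` then leaves `Φ Φᴴ H v = 0`, that is, `Φᴴ H v = 0`.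
  obtain ⟨G, hG⟩ := exists_mul_eq_of_ker_le Φᴴ (Φᴴ * H) fun v hv => by
    have hC : meanChoi p E *ᵥ v = 0 := by
      rw [← hΦ, ← Matrix.mulVec_mulVec, hv, Matrix.mulVec_zero]
    have hD := meanThetaChoi_mulVec_eq_zero hp hE hEm hC
    rw [← hHC, Matrix.neg_mulVec, Matrix.add_mulVec, ← Matrix.mulVec_mulVec, hC,
      Matrix.mulVec_zero, zero_add, neg_eq_zero, ← Matrix.mulVec_mulVec, ← hΦ] at hD
    rw [← Matrix.mulVec_mulVec]
    exact (Matrix.self_mul_conjTranspose_mulVec_eq_zero _ _).mp hD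
  refine ⟨Gᴴ, ?_⟩
  have := congrArg Matrix.conjTranspose hG
  rw [Matrix.conjTranspose_mul, Matrix.conjTranspose_mul, Matrix.conjTranspose_conjTranspose,
    hH.eq] at this
  exact this.symm

end Choi

/-! ### Entrywise conjugation -/

section Conj

variable {m n k : Type*}

theorem conj_apply (M : Matrix m n ℂ) (i : m) (j : n) : conj M i j = star (M i j) := rfl

theorem conj_mul [Fintype n] (M : Matrix m n ℂ) (N : Matrix n k ℂ) :
    conj (M * N) = conj M * conj N := Matrix.map_mul

theorem conj_add (M N : Matrix m n ℂ) : conj (M + N) = conj M + conj N := by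
  ext; simp [conj_apply]

theorem conj_neg (M : Matrix m n ℂ) : conj (-M) = -conj M := by
  ext; simp [conj_apply]

theorem conj_smul (c : ℂ) (M : Matrix m n ℂ) : conj (c • M) = star c • conj M := by
  ext; simp [conj_apply]

theorem conj_conjTranspose (M : Matrix m n ℂ) : conj Mᴴ = (conj M)ᴴ := rfl

theorem conj_eq_transpose {M : Matrix n n ℂ} (hM : M.IsHermitian) : conj M = Mᵀ := by
  ext i j; rw [conj_apply, hM.apply]; rfl

theorem isHermitian_conj {M : Matrix n n ℂ} (hM : M.IsHermitian) : (conj M).IsHermitian := by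
  rw [Matrix.IsHermitian, ← conj_conjTranspose, hM.eq]

theorem trace_conj [Fintype n] (M : Matrix n n ℂ) : (conj M).trace = star M.trace := by
  simp [Matrix.trace, conj_apply]

theorem im_trace_mul_eq_zero [Fintype n] {M N : Matrix n n ℂ} (hM : M.IsHermitian)
    (hN : N.IsHermitian) : (M * N).trace.im = 0 := by
  have h : star (M * N).trace = (M * N).trace := by
    rw [← Matrix.trace_conjTranspose, Matrix.conjTranspose_mul, hM.eq, hN.eq, Matrix.trace_mul_comm]
  exact Complex.conj_eq_iff_im.mp h

end Conj

/-! ### Partial traces, link products and pure strategies -/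

section PartialTrace

variable {N F : Type*} [Fintype N] [DecidableEq N] [Fintype F] [DecidableEq F]

/-- `tr_F [X (𝕀 ⊗ Y)]`. -/
def traceRightMul (X : Matrix (N × F) (N × F) ℂ) (Y : Matrix F F ℂ) : Matrix N N ℂ :=
  Matrix.of fun a b => ∑ f, ∑ g, X (a, f) (b, g) * Y g f

omit [Fintype N] [DecidableEq N] in
theorem traceRightMul_one (X : Matrix (N × F) (N × F) ℂ) : traceRightMul X 1 = traceRight X := by
  ext a b
  simp [traceRightMul, traceRight, Matrix.one_apply]

omit [Fintype N] [DecidableEq N] [DecidableEq F] in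
theorem traceRightMul_conjTranspose {X : Matrix (N × F) (N × F) ℂ} (hX : X.IsHermitian)
    (Y : Matrix F F ℂ) : (traceRightMul X Y)ᴴ = traceRightMul X Yᴴ := by
  ext a b
  simp only [traceRightMul, Matrix.conjTranspose_apply, Matrix.of_apply, star_sum, star_mul', hX.apply]
  rw [Finset.sum_comm]

-- Expectations of `Y` in the output state become expectations of an operator on `H_IO` alone, which
-- is how a measurement is pulled back to the primal variables.
omit [DecidableEq N] in
theorem trace_link_mul (X : Matrix (N × F) (N × F) ℂ) (C : Matrix N N ℂ) (Y : Matrix F F ℂ) :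
    (link X C * Y).trace = (traceRightMul X Y * Cᵀ).trace := by
  simp only [Matrix.trace, Matrix.diag, Matrix.mul_apply, link_apply, traceRightMul,
    Matrix.of_apply, Matrix.transpose_apply, Finset.sum_mul]
  simp only [fun f : F → N → ℂ => Finset.sum_comm (s := Finset.univ) (t := Finset.univ) (f := f)]
  refine Finset.sum_congr rfl fun a _ => Finset.sum_congr rfl fun b _ =>
    Finset.sum_congr rfl fun f _ => Finset.sum_congr rfl fun g _ => ?_
  ring

variable (N) in
/-- `Y e_k ⊗ 𝕀`. -/
def insertCol (Y : Matrix F F ℂ) (k : F) : Matrix (N × F) N ℂ :=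
  Matrix.of fun a b => if a.1 = b then Y a.2 k else 0

omit [DecidableEq F] in
theorem sum_insertCol (X : Matrix (N × F) (N × F) ℂ) (Y Z : Matrix F F ℂ) :
    ∑ k, (insertCol N Y k)ᴴ * X * insertCol N Z k = traceRightMul X (Z * Yᴴ) := by
  ext a b
  simp only [Matrix.sum_apply, Matrix.mul_apply, insertCol, Matrix.conjTranspose_apply,
    Matrix.of_apply, Fintype.sum_prod_type, traceRightMul, apply_ite star, star_zero, ite_mul,
    zero_mul, mul_ite, mul_zero, Finset.sum_ite_irrel, Finset.sum_const_zero, Finset.sum_ite_eq',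
    Finset.mem_univ, if_true, Finset.mul_sum, Finset.sum_mul]
  rw [Finset.sum_comm]
  simp only [fun i => Finset.sum_comm (s := Finset.univ) (t := Finset.univ)
    (f := fun c x => star (Y x c) * X (a, x) (b, i) * Z i c)]
  rw [Finset.sum_comm]
  refine Finset.sum_congr rfl fun f _ => Finset.sum_congr rfl fun g _ =>
    Finset.sum_congr rfl fun k _ => ?_
  ring

/-- Inserting basis vectors of `H_F`, transformed by `1` in the first block and by `S` in the
second, writes the block matrix as a sum of congruences `Vᴴ X V`. This supplies the block constraint
of the primal program. -/
theorem posSemidef_fromBlocks_traceRightMul {q : Type*} [Fintype q]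
    {X : Matrix (N × F) (N × F) ℂ} (hX : X.PosSemidef)
    {S : Matrix F F ℂ} (hS : S.IsHermitian) (Ψ : Matrix N q ℂ) :
    (Matrix.fromBlocks (traceRight X) (Ψᴴ * traceRightMul X S)ᴴ (Ψᴴ * traceRightMul X S)
      (Ψᴴ * traceRightMul X (S ^ 2) * Ψ)).PosSemidef := by
  have h : Matrix.fromBlocks (traceRight X) (Ψᴴ * traceRightMul X S)ᴴ (Ψᴴ * traceRightMul X S)
      (Ψᴴ * traceRightMul X (S ^ 2) * Ψ) =
      ∑ k, (Matrix.fromCols (insertCol N 1 k) (insertCol N S k * Ψ))ᴴ * X *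
        Matrix.fromCols (insertCol N (1 : Matrix F F ℂ) k) (insertCol N S k * Ψ) := by
    have e : ∀ k, (Matrix.fromCols (insertCol N 1 k) (insertCol N S k * Ψ))ᴴ * X *
        Matrix.fromCols (insertCol N (1 : Matrix F F ℂ) k) (insertCol N S k * Ψ) =
        Matrix.fromBlocks ((insertCol N 1 k)ᴴ * X * insertCol N 1 k)
          (((insertCol N 1 k)ᴴ * X * insertCol N S k) * Ψ)
          (Ψᴴ * ((insertCol N S k)ᴴ * X * insertCol N 1 k))
          (Ψᴴ * ((insertCol N S k)ᴴ * X * insertCol N S k) * Ψ) := fun k => by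
      rw [Matrix.conjTranspose_fromCols_eq_fromRows_conjTranspose, Matrix.fromRows_mul,
        Matrix.fromRows_mul_fromCols, Matrix.conjTranspose_mul]
      simp only [Matrix.mul_assoc]
    have hsum : ∀ (A : F → Matrix N N ℂ) (B : F → Matrix N q ℂ) (C : F → Matrix q N ℂ)
        (D : F → Matrix q q ℂ), ∑ k, Matrix.fromBlocks (A k) (B k) (C k) (D k) =
          Matrix.fromBlocks (∑ k, A k) (∑ k, B k) (∑ k, C k) (∑ k, D k) := by
      intro A B C D
      ext i j
      rcases i with i | i <;> rcases j with j | j <;> simp [Matrix.sum_apply]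
    simp only [e]
    rw [hsum, ← Matrix.sum_mul, ← Matrix.mul_sum, ← Matrix.sum_mul, ← Matrix.mul_sum]
    simp only [sum_insertCol, Matrix.conjTranspose_one, one_mul, mul_one, hS.eq, pow_two,
      traceRightMul_one, Matrix.conjTranspose_mul, Matrix.conjTranspose_conjTranspose,
      traceRightMul_conjTranspose hX.1]
  rw [h]
  exact Matrix.posSemidef_sum _ fun k _ => hX.conjTranspose_mul_mul_same _

/-- The rank-one strategy with amplitudes `Q`. -/
def pureStrategy (Q : Matrix N F ℂ) : Matrix (N × F) (N × F) ℂ :=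
  Matrix.vecMulVec (fun a => Q a.1 a.2) (star fun a => Q a.1 a.2)

omit [Fintype N] [DecidableEq N] [DecidableEq F] in
theorem traceRight_pureStrategy (Q : Matrix N F ℂ) : traceRight (pureStrategy Q) = Q * Qᴴ := by
  ext a b
  simp [traceRight, pureStrategy, Matrix.vecMulVec_apply, Matrix.mul_apply]

-- The transpose in the link product makes the output state the conjugate of `Qᴴ C* Q`; this is why
-- `Φ` and `H` enter the optimization conjugated.
omit [DecidableEq N] in
theorem link_pureStrategy (Q : Matrix N F ℂ) (C : Matrix N N ℂ) :
    link (pureStrategy Q) C = conj (Qᴴ * conj C * Q) := by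
  ext f g
  simp only [link_apply, pureStrategy, Matrix.vecMulVec_apply, conj_apply, Matrix.mul_apply,
    Matrix.conjTranspose_apply, star_sum, star_mul', star_star, Pi.star_apply, Finset.sum_mul]
  rw [Finset.sum_comm]
  refine Finset.sum_congr rfl fun a _ => Finset.sum_congr rfl fun b _ => ?_
  ring

omit [DecidableEq N] in
theorem exists_eq_mul_conjTranspose {X : Matrix N N ℂ} (hX : X.PosSemidef) :
    ∃ (d : ℕ) (Q : Matrix N (Fin d) ℂ), X = Q * Qᴴ := by
  obtain ⟨d, v, hv⟩ := Matrix.posSemidef_iff_eq_sum_vecMulVec.mp hX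
  refine ⟨d, Matrix.of fun a i => v i a, ?_⟩
  rw [hv]
  ext a b
  simp [Matrix.sum_apply, Matrix.vecMulVec_apply, Matrix.mul_apply]

end PartialTrace

/-! ### Reduced strategies and the inner minimization over `h` -/

section Values

variable {I O : Type*} [Fintype I] [DecidableEq I] [Nonempty I] [Fintype O] [DecidableEq O]
  [Nonempty O]

theorem exists_mem_seq₁₂_inter_seq₂₁ : ∃ X, X ∈ seq₁₂ I O ∧ X ∈ seq₂₁ I O := by
  have hI : (Fintype.card I : ℂ) ≠ 0 := by simp
  have hps : ((((Fintype.card I : ℂ) ^ 2)⁻¹) • (1 : Matrix (Sys I O) (Sys I O) ℂ)).PosSemidef := by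
    refine Matrix.PosSemidef.one.smul ?_
    simp
  have htr : ((((Fintype.card I : ℂ) ^ 2)⁻¹) • (1 : Matrix (Sys I O) (Sys I O) ℂ)).trace =
      (Fintype.card O : ℂ) ^ 2 := by
    rw [Matrix.trace_smul, Matrix.trace_one, Fintype.card_prod, Fintype.card_prod, smul_eq_mul]
    push_cast
    field_simp
  refine ⟨(((Fintype.card I : ℂ) ^ 2)⁻¹) • 1, ⟨hps, ?_, htr⟩, ⟨hps, ?_, htr⟩⟩
  · rw [Lam₁₂_eq, map_smul, isCausalProjection_lam₁₂.map_one]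
  · rw [Lam₂₁_eq, map_smul, isCausalProjection_lam₂₁.map_one]

/-- The mixing weights are absorbed into the two operators and recovered from their traces. This
makes the set visibly the `X₁ + X₂` part of the primal feasible set. -/
theorem mem_redStrategies_iff {X : Matrix (Sys I O) (Sys I O) ℂ} :
    X ∈ redStrategies I O ↔ ∃ X₁ X₂ : Matrix (Sys I O) (Sys I O) ℂ,
      X₁.PosSemidef ∧ X₂.PosSemidef ∧ Lam₁₂ X₁ = X₁ ∧ Lam₂₁ X₂ = X₂ ∧
        X₁.trace + X₂.trace = (Fintype.card O : ℂ) ^ 2 ∧ X = X₁ + X₂ := by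
  constructor
  · rintro ⟨t, ht0, ht1, X₁, ⟨h1, h2, h3⟩, X₂, ⟨h4, h5, h6⟩, rfl⟩
    refine ⟨_, _, h1.smul (α := ℂ) (by exact_mod_cast ht0), h4.smul (α := ℂ)
      (Complex.zero_le_real.mpr (sub_nonneg.mpr ht1)), ?_, ?_, ?_, rfl⟩
    · rw [Lam₁₂_eq, map_smul, ← Lam₁₂_eq, h2]
    · rw [Lam₂₁_eq, map_smul, ← Lam₂₁_eq, h5]
    · rw [Matrix.trace_smul, Matrix.trace_smul, h3, h6, ← add_smul]
      push_cast
      simp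
  · rintro ⟨X₁, X₂, h1, h2, h3, h4, h5, rfl⟩
    have hO : (0 : ℝ) < (Fintype.card O : ℝ) ^ 2 := by positivity
    have hOc : (Fintype.card O : ℂ) ≠ 0 := by simp
    have hre : ∀ {X : Matrix (Sys I O) (Sys I O) ℂ}, X.PosSemidef → 0 ≤ X.trace.re ∧
        X.trace = (X.trace.re : ℂ) := fun hX => by
      have := Complex.le_def.mp hX.trace_nonneg
      exact ⟨this.1, Complex.ext rfl this.2.symm⟩
    have hsum : X₁.trace.re + X₂.trace.re = (Fintype.card O : ℝ) ^ 2 := by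
      rw [(hre h1).2, (hre h2).2] at h5
      exact_mod_cast h5
    obtain ⟨Z, hZ1, hZ2⟩ := exists_mem_seq₁₂_inter_seq₂₁ (I := I) (O := O)
    have key : ∀ (L : Module.End ℂ (Matrix (Sys I O) (Sys I O) ℂ))
        {X : Matrix (Sys I O) (Sys I O) ℂ}, X.PosSemidef → L X = X → L Z = Z → Z.PosSemidef →
        Z.trace = (Fintype.card O : ℂ) ^ 2 →
        ∃ X', (X'.PosSemidef ∧ L X' = X' ∧ X'.trace = (Fintype.card O : ℂ) ^ 2) ∧
          ((X.trace.re / (Fintype.card O : ℝ) ^ 2 : ℝ) : ℂ) • X' = X := by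
      intro L X hX hL hLZ hZ hZt
      rcases (hre hX).1.eq_or_lt with h | h
      -- A component of trace zero vanishes and cannot be normalized; the normalized strategy `Z`
      -- takes its place with weight zero.
      · have : X = 0 := by
          rw [← hX.trace_eq_zero_iff, (hre hX).2, ← h, Complex.ofReal_zero]
        exact ⟨Z, ⟨hZ, hLZ, hZt⟩, by simp [this]⟩
      · have hc : (X.trace.re : ℂ) ≠ 0 := by exact_mod_cast h.ne'
        refine ⟨(((Fintype.card O : ℝ) ^ 2 / X.trace.re : ℝ) : ℂ) • X, ⟨hX.smul (α := ℂ) ?_, ?_, ?_⟩, ?_⟩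
        · exact Complex.zero_le_real.mpr (by positivity)
        · rw [map_smul, hL]
        · rw [Matrix.trace_smul, (hre hX).2]
          push_cast
          simp only [Complex.ofReal_re, smul_eq_mul]
          field_simp
        · rw [smul_smul]
          push_cast
          rw [div_mul_div_cancel₀ (by simp), div_self hc, one_smul]
    obtain ⟨X₁', hX₁', e1⟩ := key (lam₁₂ I O) h1 h3 hZ1.2.1 hZ1.1 hZ1.2.2
    obtain ⟨X₂', hX₂', e2⟩ := key (lam₂₁ I O) h2 h4 hZ2.2.1 hZ1.1 hZ1.2.2
    refine ⟨X₁.trace.re / (Fintype.card O : ℝ) ^ 2, div_nonneg (hre h1).1 hO.le,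
      (div_le_one hO).mpr (by linarith [(hre h2).1]), X₁', hX₁', X₂', hX₂', ?_⟩
    have : 1 - X₁.trace.re / (Fintype.card O : ℝ) ^ 2 = X₂.trace.re / (Fintype.card O : ℝ) ^ 2 := by
      field_simp
      linarith
    rw [this, e1, e2]

omit [DecidableEq I] [DecidableEq O] [Nonempty I] [Nonempty O] in
theorem gap_eq {q : ℕ} {H : Matrix (Sys I O) (Sys I O) ℂ} {Φ : Matrix (Sys I O) (Fin q) ℂ}
    {G : Matrix (Fin q) (Fin q) ℂ} (hG : H * Φ = Φ * G) (h : Matrix (Fin q) (Fin q) ℂ) :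
    gap H Φ h = conj Φ * (conj G - Complex.I • h) := by
  rw [gap, ← conj_mul, hG, conj_mul, Matrix.mul_sub, Matrix.mul_smul]

-- Invariance of the range of `Φ` and cyclicity of the trace leave only the compression of `X` by
-- `Φ*`, a positive `q × q` matrix.
omit [DecidableEq I] [DecidableEq O] [Nonempty I] [Nonempty O] in
theorem trace_mul_Omega {q : ℕ} {H : Matrix (Sys I O) (Sys I O) ℂ}
    {Φ : Matrix (Sys I O) (Fin q) ℂ} {G : Matrix (Fin q) (Fin q) ℂ} (hG : H * Φ = Φ * G)
    (X : Matrix (Sys I O) (Sys I O) ℂ) (h : Matrix (Fin q) (Fin q) ℂ) :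
    (X * Omega H Φ h).trace.re = 4 * (((conj Φ)ᴴ * X * conj Φ) *
      ((conj G - Complex.I • h) * (conj G - Complex.I • h)ᴴ)).trace.re := by
  rw [Omega, gap_eq hG, Matrix.mul_smul, Matrix.trace_smul, smul_eq_mul, Complex.mul_re]
  have : (X * (conj Φ * (conj G - Complex.I • h) * (conj Φ * (conj G - Complex.I • h))ᴴ)).trace =
      (((conj Φ)ᴴ * X * conj Φ) *
      ((conj G - Complex.I • h) * (conj G - Complex.I • h)ᴴ)).trace := by
    rw [Matrix.conjTranspose_mul, Matrix.trace_mul_comm,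
      show conj Φ * (conj G - Complex.I • h) * ((conj G - Complex.I • h)ᴴ * (conj Φ)ᴴ) * X =
        conj Φ * ((conj G - Complex.I • h) * ((conj G - Complex.I • h)ᴴ * (conj Φ)ᴴ * X)) by
        simp only [Matrix.mul_assoc], Matrix.trace_mul_comm,
      show (conj G - Complex.I • h) * ((conj G - Complex.I • h)ᴴ * (conj Φ)ᴴ * X) * conj Φ =
        ((conj G - Complex.I • h) * (conj G - Complex.I • h)ᴴ) * ((conj Φ)ᴴ * X * conj Φ) by
        simp only [Matrix.mul_assoc], Matrix.trace_mul_comm]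
  rw [this]; simp

/-- The stationarity condition of the inner minimization. -/
theorem exists_isHermitian_stationary {n : Type*} [Fintype n] {R : Matrix n n ℂ}
    (hR : R.PosSemidef) (G : Matrix n n ℂ) :
    ∃ h : Matrix n n ℂ, h.IsHermitian ∧ (R * (G - Complex.I • h)).IsHermitian := by
  obtain ⟨h, hh, e⟩ := exists_isHermitian_mul_add_mul hR G
  refine ⟨h, hh, ?_⟩
  have e2 : Complex.I • (h * R) + Complex.I • (R * h) = R * G - Gᴴ * R := by
    rw [← smul_add, e, smul_smul, Complex.I_mul_I]; simp
  rw [Matrix.IsHermitian, Matrix.conjTranspose_mul, Matrix.conjTranspose_sub,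
    Matrix.conjTranspose_smul, hh.eq, hR.1.eq, Matrix.mul_sub, Matrix.sub_mul, Matrix.mul_smul,
    Matrix.smul_mul, Complex.star_def, Complex.conj_I, neg_smul, sub_neg_eq_add]
  rw [eq_sub_iff_add_eq, add_assoc, e2]
  abel

/-- A stationary point minimizes. -/
theorem re_trace_le_of_stationary {n : Type*} [Fintype n] {R G h h' : Matrix n n ℂ}
    (hR : R.PosSemidef) (hh : h.IsHermitian) (hh' : h'.IsHermitian)
    (hst : (R * (G - Complex.I • h)).IsHermitian) :
    (R * ((G - Complex.I • h) * (G - Complex.I • h)ᴴ)).trace.re ≤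
      (R * ((G - Complex.I • h') * (G - Complex.I • h')ᴴ)).trace.re := by
  set N := G - Complex.I • h with hN
  set δ := h' - h with hδ
  have hδh : δ.IsHermitian := hh'.sub hh
  have e : G - Complex.I • h' = N - Complex.I • δ := by
    rw [hN, hδ, smul_sub]; abel
  have e2 : (N - Complex.I • δ)ᴴ = Nᴴ + Complex.I • δ := by
    rw [Matrix.conjTranspose_sub, Matrix.conjTranspose_smul, hδh.eq, Complex.star_def,
      Complex.conj_I, neg_smul, sub_neg_eq_add]
  -- The terms linear in `δ` are `i` times numbers that stationarity makes real, so they drop out of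
  -- the real part; the quadratic term is nonnegative.
  have e3 : R * ((N - Complex.I • δ) * (N - Complex.I • δ)ᴴ) =
      R * (N * Nᴴ) + Complex.I • (R * N * δ) - Complex.I • (R * δ * Nᴴ) + R * (δ * δ) := by
    rw [e2]
    simp only [Matrix.sub_mul, Matrix.mul_add, Matrix.mul_sub, Matrix.mul_smul, Matrix.smul_mul,
      smul_smul, Complex.I_mul_I, neg_smul, one_smul, Matrix.mul_assoc, smul_sub, Matrix.mul_neg]
    abel
  have h1 : (R * N * δ).trace.im = 0 := im_trace_mul_eq_zero hst hδh
  have h2 : (R * δ * Nᴴ).trace.im = 0 := by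
    have : (R * δ * Nᴴ).trace = (R * N * δ).trace := by
      rw [Matrix.trace_mul_comm, ← Matrix.mul_assoc,
        show Nᴴ * R = (R * N)ᴴ by rw [Matrix.conjTranspose_mul, hR.1.eq], hst.eq]
    rw [this, h1]
  have h3 : 0 ≤ (R * (δ * δ)).trace.re := by
    refine trace_mul_re_nonneg hR ?_
    have h4 := Matrix.posSemidef_conjTranspose_mul_self δ
    rwa [hδh.eq] at h4
  rw [e, e3]
  simp only [Matrix.trace_add, Matrix.trace_sub, Matrix.trace_smul, Complex.add_re, Complex.sub_re,
    smul_eq_mul, Complex.I_mul_re, h1, h2]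
  linarith

end Values

/-! ### Information gained, between the max-min problem and the primal program -/

section Information

open MeasureTheory

variable {I O : Type*} [Fintype I] [DecidableEq I] [Fintype O] [DecidableEq O]
  {q : ℕ} {H : Matrix (Sys I O) (Sys I O) ℂ} {Φ : Matrix (Sys I O) (Fin q) ℂ}
  {G : Matrix (Fin q) (Fin q) ℂ}

omit [DecidableEq I] [DecidableEq O] in
/-- The minimum over `h` is attained at stationary points. -/
theorem isLeast_trace_mul_Omega (hG : H * Φ = Φ * G) {X : Matrix (Sys I O) (Sys I O) ℂ}
    (hX : X.PosSemidef) {h : Matrix (Fin q) (Fin q) ℂ} (hh : h.IsHermitian)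
    (hst : (((conj Φ)ᴴ * X * conj Φ) * (conj G - Complex.I • h)).IsHermitian) :
    IsLeast {w | ∃ h : Matrix (Fin q) (Fin q) ℂ, h.IsHermitian ∧
      w = (X * Omega H Φ h).trace.re} (X * Omega H Φ h).trace.re := by
  refine ⟨⟨h, hh, rfl⟩, ?_⟩
  rintro w ⟨h', hh', rfl⟩
  rw [trace_mul_Omega hG, trace_mul_Omega hG]
  have := re_trace_le_of_stationary (hX.conjTranspose_mul_mul_same (conj Φ)) hh hh' hst
  linarith

omit [DecidableEq I] [DecidableEq O] in
theorem exists_isLeast_trace_mul_Omega (hG : H * Φ = Φ * G) {X : Matrix (Sys I O) (Sys I O) ℂ}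
    (hX : X.PosSemidef) :
    ∃ v, IsLeast {w | ∃ h : Matrix (Fin q) (Fin q) ℂ, h.IsHermitian ∧
      w = (X * Omega H Φ h).trace.re} v := by
  obtain ⟨h, hh, hst⟩ := exists_isHermitian_stationary
    (hX.conjTranspose_mul_mul_same (conj Φ)) (conj G)
  exact ⟨_, isLeast_trace_mul_Omega hG hX hh hst⟩

variable {p : Measure ℝ} [IsProbabilityMeasure p] {E : ℝ → Matrix I I ℂ →ₗ[ℂ] Matrix O O ℂ}

/-- An optimal measurement strategy for a given reduced strategy. -/
theorem maxMinValues_subset_informationValues [Nonempty I] [Nonempty O]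
    (hp : Integrable (fun θ : ℝ => θ) p) (hE : ∀ θ, IsChannel (E θ))
    (hEm : ∀ (ρ : Matrix I I ℂ) (a b : O), AEMeasurable (fun θ => E θ ρ a b) p)
    (hH : H.IsHermitian) (hHC : -(H * meanChoi p E + meanChoi p E * H) = meanThetaChoi p E)
    (hΦ : Φ * Φᴴ = meanChoi p E) (hG : H * Φ = Φ * G) :
    maxMinValues H Φ ⊆ informationValues p E := by
  rintro v ⟨X, hX, hv⟩
  have hXps : X.PosSemidef := by
    obtain ⟨X₁, X₂, h1, h2, -, -, -, rfl⟩ := mem_redStrategies_iff.mp hX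
    exact h1.add h2
  obtain ⟨d, Q, rfl⟩ := exists_eq_mul_conjTranspose hXps
  obtain ⟨h, hh, hst⟩ := exists_isHermitian_stationary
    (hXps.conjTranspose_mul_mul_same (conj Φ)) (conj G)
  have hv' := hv.unique (isLeast_trace_mul_Omega hG hXps hh hst)
  -- Stationarity makes `R N` Hermitian, so it equals `R Z R` with `Z` Hermitian. Sandwiching `Z` by
  -- `M` gives an operator on the purifying space.
  obtain ⟨Z, hZ, eZ⟩ := exists_isHermitian_mul_mul (hXps.conjTranspose_mul_mul_same (conj Φ)) hst
  rw [trace_mul_Omega hG] at hv'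
  set N := conj G - Complex.I • h with hN
  set M := Qᴴ * conj Φ with hM
  have hR : (conj Φ)ᴴ * (Q * Qᴴ) * conj Φ = Mᴴ * M := by
    rw [hM, Matrix.conjTranspose_mul, Matrix.conjTranspose_conjTranspose]
    simp only [Matrix.mul_assoc]
  rw [hR] at hv' eZ
  -- `Mᴴ M` and `M` have the same kernel, so the leading `Mᴴ` can be cancelled.
  have hMZ : M * (Z * (Mᴴ * M)) = M * N := by
    rw [← sub_eq_zero, ← Matrix.mul_sub, ← Matrix.conjTranspose_mul_self_mul_eq_zero,
      Matrix.mul_sub, ← Matrix.mul_assoc, eZ, sub_self]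
  -- Since `T M = -2 M N`, the mean of `M Mᴴ T` and `T M Mᴴ` is `-M (N + Nᴴ) Mᴴ`. This is the first
  -- moment because `N + Nᴴ = G* + (G*)ᴴ`; the factor `-2` comes from the sign in the equation for
  -- `H` and from the one half in the equation for `S`.
  set T : Matrix (Fin d) (Fin d) ℂ := (-2 : ℂ) • (M * Z * Mᴴ) with hT
  have hTh : T.IsHermitian := by
    rw [Matrix.IsHermitian, hT, Matrix.conjTranspose_smul,
      (Matrix.isHermitian_mul_mul_conjTranspose M hZ).eq]
    simp
  have hTM : T * M = (-2 : ℂ) • (M * N) := by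
    rw [hT, Matrix.smul_mul, ← hMZ]
    simp only [Matrix.mul_assoc]
  clear_value M N T
  have hC : Qᴴ * conj (meanChoi p E) * Q = M * Mᴴ := by
    rw [← hΦ, conj_mul, conj_conjTranspose, hM, Matrix.conjTranspose_mul,
      Matrix.conjTranspose_conjTranspose]
    simp only [Matrix.mul_assoc]
  have hKG : conj H * conj Φ = conj Φ * conj G := by rw [← conj_mul, hG, conj_mul]
  have hKG' : (conj Φ)ᴴ * conj H = (conj G)ᴴ * (conj Φ)ᴴ := by
    rw [← Matrix.conjTranspose_mul, ← hKG, Matrix.conjTranspose_mul, (isHermitian_conj hH).eq]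
  have hD : Qᴴ * conj (meanThetaChoi p E) * Q = -(M * (conj G + (conj G)ᴴ) * Mᴴ) := by
    have e : conj (Φ * Φᴴ) = conj Φ * (conj Φ)ᴴ := conj_mul _ _
    rw [← hHC, ← hΦ, conj_neg, conj_add, conj_mul H, conj_mul _ H, e, hM, Matrix.conjTranspose_mul,
      Matrix.conjTranspose_conjTranspose, ← Matrix.mul_assoc, hKG,
      Matrix.mul_assoc (conj Φ) (conj Φ)ᴴ, hKG']
    simp only [Matrix.mul_neg, Matrix.neg_mul, Matrix.mul_add, Matrix.add_mul, Matrix.mul_assoc]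
  have hNG : conj G + (conj G)ᴴ = N + Nᴴ := by
    rw [hN, Matrix.conjTranspose_sub, Matrix.conjTranspose_smul, hh.eq, Complex.star_def,
      Complex.conj_I, neg_smul]
    abel
  have hTMM : T * (M * Mᴴ) = (-2 : ℂ) • (M * N * Mᴴ) := by
    rw [← Matrix.mul_assoc, hTM, Matrix.smul_mul]
  have hMMT : M * Mᴴ * T = (-2 : ℂ) • (M * Nᴴ * Mᴴ) := by
    have := congrArg Matrix.conjTranspose hTMM
    simpa [Matrix.conjTranspose_mul, Matrix.conjTranspose_smul, hTh.eq, Matrix.mul_assoc] using this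
  have hρ : meanState p E (pureStrategy Q) = conj (M * Mᴴ) := by
    rw [meanState_eq hE hEm, link_pureStrategy, hC]
  refine ⟨d, pureStrategy Q, ⟨Matrix.posSemidef_vecMulVec_self_star _, ?_⟩, conj T,
    isHermitian_conj hTh, ?_, ?_⟩
  · rwa [traceRight_pureStrategy]
  · rw [meanThetaState_eq hp hE hEm, hρ, link_pureStrategy, hD, hNG, ← conj_mul, ← conj_mul,
      ← conj_add, hMMT, hTMM, show (1 / 2 : ℂ) = star (1 / 2 : ℂ) by simp, ← conj_smul]
    congr 1
    rw [← smul_add, smul_smul, Matrix.mul_add, Matrix.add_mul, add_comm]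
    norm_num
    abel
  · rw [hρ, pow_two, ← conj_mul, ← conj_mul, trace_conj, Complex.star_def, Complex.conj_re, hv']
    have e1 : (M * Mᴴ * (T * T)).trace = ((T * M) * (T * M)ᴴ).trace := by
      rw [Matrix.conjTranspose_mul, hTh.eq, ← Matrix.mul_assoc, Matrix.trace_mul_comm]
      simp only [Matrix.mul_assoc]
    have e2 : (Mᴴ * M * (N * Nᴴ)).trace = (M * N * (M * N)ᴴ).trace := by
      rw [Matrix.conjTranspose_mul, Matrix.mul_assoc, Matrix.trace_mul_comm]
      simp only [Matrix.mul_assoc]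
    rw [e1, hTM, e2, Matrix.conjTranspose_smul, Matrix.smul_mul, Matrix.mul_smul, smul_smul,
      Matrix.trace_smul]
    simp
    norm_num

/-- Every strategy together with its optimal measurement yields a feasible point of the primal
program. -/
theorem informationValues_subset_primalValues [Nonempty I] [Nonempty O]
    (hp : Integrable (fun θ : ℝ => θ) p) (hE : ∀ θ, IsChannel (E θ))
    (hEm : ∀ (ρ : Matrix I I ℂ) (a b : O), AEMeasurable (fun θ => E θ ρ a b) p)
    (hH : H.IsHermitian) (hHC : -(H * meanChoi p E + meanChoi p E * H) = meanThetaChoi p E)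
    (hΦ : Φ * Φᴴ = meanChoi p E) :
    informationValues p E ⊆ primalValues H Φ := by
  rintro j ⟨d, X, ⟨hX, hXr⟩, S, hS, hSLD, rfl⟩
  obtain ⟨X₁, X₂, h1, h2, h3, h4, h5, h6⟩ := mem_redStrategies_iff.mp hXr
  set A := traceRightMul X S with hA
  have hAh : A.IsHermitian := by
    rw [Matrix.IsHermitian, hA, traceRightMul_conjTranspose hX.1, hS.eq]
  -- With this choice `tr C = J`, while the equation for `S` gives `J = -2 Re tr (H* Φ* B)`. The
  -- objective is therefore `-J + 2 J = J`.
  refine ⟨X₁, X₂, (conj Φ)ᴴ * A, (conj Φ)ᴴ * traceRightMul X (S ^ 2) * conj Φ, h1, h2, h3, h4, h5,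
    ?_, Matrix.isHermitian_conjTranspose_mul_mul _ hAh, ?_⟩
  · rw [← h6]
    exact posSemidef_fromBlocks_traceRightMul hX hS (conj Φ)
  have hCT : (meanChoi p E)ᵀ = conj Φ * (conj Φ)ᴴ := by
    rw [← hΦ, ← conj_eq_transpose (Matrix.isHermitian_mul_conjTranspose_self Φ), conj_mul,
      conj_conjTranspose]
  have hHT : Hᵀ = conj H := (conj_eq_transpose hH).symm
  have hJ : (meanState p E X * S ^ 2).trace =
      ((conj Φ)ᴴ * traceRightMul X (S ^ 2) * conj Φ).trace := by
    rw [meanState_eq hE hEm, trace_link_mul, hCT, ← Matrix.mul_assoc, Matrix.trace_mul_comm,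
      Matrix.mul_assoc]
  have hJ' : (meanState p E X * S ^ 2).trace = (meanThetaState p E X * S).trace := by
    rw [hSLD, Matrix.smul_mul, Matrix.add_mul, Matrix.trace_smul, Matrix.trace_add, pow_two,
      Matrix.mul_assoc S, Matrix.trace_mul_comm S, Matrix.mul_assoc, ← two_mul,
      smul_eq_mul]
    ring
  have hJ'' : (meanThetaState p E X * S).trace =
      -((conj H * conj Φ * ((conj Φ)ᴴ * A)).trace + (conj H * conj Φ * ((conj Φ)ᴴ * A))ᴴ.trace) := by
    rw [meanThetaState_eq hp hE hEm, trace_link_mul, ← hHC, Matrix.transpose_neg,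
      Matrix.transpose_add, Matrix.transpose_mul, Matrix.transpose_mul, hCT, hHT, ← hA,
      Matrix.mul_neg, Matrix.trace_neg, Matrix.mul_add, Matrix.trace_add, add_comm]
    congr 2
    · rw [Matrix.trace_mul_comm]
      simp only [Matrix.mul_assoc]
    · simp only [Matrix.conjTranspose_mul, Matrix.conjTranspose_conjTranspose, hAh.eq,
        (isHermitian_conj hH).eq, Matrix.mul_assoc]
  have e := congrArg Complex.re (hJ'.trans hJ'')
  rw [Complex.neg_re, Complex.add_re, re_trace_conjTranspose] at e
  rw [← hJ]
  linarith

end Information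

/-! ### Real quadratic forms and Hermitian parts -/

section RealQuadraticForm

variable {n : Type*} [Fintype n]

/-- The real part of the quadratic form of a matrix. -/
def reForm (M : Matrix n n ℂ) (u : n → ℂ) : ℝ := (star u ⬝ᵥ M *ᵥ u).re

theorem reForm_add (M N : Matrix n n ℂ) (u : n → ℂ) :
    reForm (M + N) u = reForm M u + reForm N u := by
  simp [reForm, Matrix.add_mulVec]

theorem reForm_smul (r : ℝ) (M : Matrix n n ℂ) (u : n → ℂ) :
    reForm (r • M) u = r * reForm M u := by
  simp [reForm, Matrix.smul_mulVec]

theorem reForm_eq_trace (M : Matrix n n ℂ) (u : n → ℂ) :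
    reForm M u = (M * Matrix.vecMulVec u (star u)).trace.re := by
  rw [Matrix.mul_vecMulVec, Matrix.trace_vecMulVec, dotProduct_comm, reForm]

theorem reForm_conjTranspose (M : Matrix n n ℂ) (u : n → ℂ) : reForm Mᴴ u = reForm M u := by
  rw [reForm_eq_trace, reForm_eq_trace, ← re_trace_conjTranspose, Matrix.conjTranspose_mul,
    Matrix.conjTranspose_conjTranspose, Matrix.conjTranspose_vecMulVec, star_star,
    Matrix.trace_mul_comm]

theorem posSemidef_of_reForm_nonneg {M : Matrix n n ℂ} (hM : M.IsHermitian)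
    (h : ∀ u, 0 ≤ reForm M u) : M.PosSemidef := by
  refine .of_dotProduct_mulVec_nonneg hM fun u => Complex.le_def.mpr ⟨h u, ?_⟩
  have := im_trace_mul_eq_zero hM (Matrix.posSemidef_vecMulVec_self_star u).1
  rw [Matrix.mul_vecMulVec, Matrix.trace_vecMulVec, dotProduct_comm] at this
  exact this.symm

theorem reForm_nonneg {M : Matrix n n ℂ} (hM : M.PosSemidef) (u : n → ℂ) : 0 ≤ reForm M u :=
  (Complex.le_def.mp (hM.dotProduct_mulVec_nonneg u)).1

/-- The Hermitian part of a matrix. -/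
noncomputable def hermPart (M : Matrix n n ℂ) : Matrix n n ℂ := (2⁻¹ : ℝ) • (M + Mᴴ)

omit [Fintype n] in
theorem isHermitian_hermPart (M : Matrix n n ℂ) : (hermPart M).IsHermitian := by
  rw [Matrix.IsHermitian, hermPart, Matrix.conjTranspose_smul, Matrix.conjTranspose_add,
    Matrix.conjTranspose_conjTranspose, add_comm, star_trivial]

theorem reForm_hermPart (M : Matrix n n ℂ) (u : n → ℂ) : reForm (hermPart M) u = reForm M u := by
  rw [hermPart, reForm_smul, reForm_add, reForm_conjTranspose]; ring

theorem re_trace_hermPart (M : Matrix n n ℂ) : (hermPart M).trace.re = M.trace.re := by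
  rw [hermPart, Matrix.trace_smul, Complex.smul_re, Matrix.trace_add, Complex.add_re,
    re_trace_conjTranspose, smul_eq_mul]; ring

theorem posSemidef_hermPart {M : Matrix n n ℂ} (h : ∀ u, 0 ≤ reForm M u) :
    (hermPart M).PosSemidef :=
  posSemidef_of_reForm_nonneg (isHermitian_hermPart M) fun u => by
    rw [reForm_hermPart]; exact h u

theorem IsCausalProjection.map_hermPart [DecidableEq n] {L : Module.End ℂ (Matrix n n ℂ)}
    (hL : IsCausalProjection L) (M : Matrix n n ℂ) : L (hermPart M) = hermPart (L M) := by
  rw [hermPart, hermPart, LinearMap.map_smul_of_tower, map_add, hL.map_conjTranspose]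

end RealQuadraticForm

/-! ### Conic duality by Riesz extension -/

section Duality

variable {N q : Type*} [Fintype N] [DecidableEq N] [Fintype q] [DecidableEq q]

variable (N q) in
/-- The variables `(X₁, X₂, B, C)` of the primal program. -/
abbrev PrimalSpace := Matrix N N ℂ × Matrix N N ℂ × Matrix q N ℂ × Matrix q q ℂ

/-- The block matrix of the primal program. -/
def primalBlock (x : PrimalSpace N q) : Matrix (N ⊕ q) (N ⊕ q) ℂ :=
  Matrix.fromBlocks (x.1 + x.2.1) x.2.2.1ᴴ x.2.2.1 x.2.2.2

omit [Fintype N] [DecidableEq N] [Fintype q] [DecidableEq q] in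
theorem primalBlock_add (x y : PrimalSpace N q) :
    primalBlock (x + y) = primalBlock x + primalBlock y := by
  simp only [primalBlock, Prod.fst_add, Prod.snd_add, Matrix.conjTranspose_add,
    Matrix.fromBlocks_add]
  congr 1
  abel

omit [Fintype N] [DecidableEq N] [Fintype q] [DecidableEq q] in
theorem primalBlock_smul (r : ℝ) (x : PrimalSpace N q) :
    primalBlock (r • x) = r • primalBlock x := by
  simp only [primalBlock, Prod.smul_fst, Prod.smul_snd, Matrix.conjTranspose_smul, star_trivial,
    Matrix.fromBlocks_smul, smul_add]

variable (N q) in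
/-- The cone of the primal program, without the symmetry conditions. -/
def primalCone : PointedCone ℝ (PrimalSpace N q) where
  -- Only real parts of quadratic forms are constrained, so anti-Hermitian parts are free. A large
  -- multiple of the identity then dominates every element of the full real vector space, as the
  -- extension theorem requires.
  carrier := {x | (∀ u, 0 ≤ reForm x.1 u) ∧ (∀ u, 0 ≤ reForm x.2.1 u) ∧
    ∀ z, 0 ≤ reForm (primalBlock x) z}
  zero_mem' := by
    refine ⟨fun u => ?_, fun u => ?_, fun z => ?_⟩ <;> simp [reForm, primalBlock]
  add_mem' := by
    rintro x y ⟨h1, h2, h3⟩ ⟨h4, h5, h6⟩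
    refine ⟨fun u => ?_, fun u => ?_, fun z => ?_⟩
    · rw [Prod.fst_add, reForm_add]; exact add_nonneg (h1 u) (h4 u)
    · rw [Prod.snd_add, Prod.fst_add, reForm_add]; exact add_nonneg (h2 u) (h5 u)
    · rw [primalBlock_add, reForm_add]; exact add_nonneg (h3 z) (h6 z)
  smul_mem' := by
    rintro ⟨r, hr⟩ x ⟨h1, h2, h3⟩
    refine ⟨fun u => ?_, fun u => ?_, fun z => ?_⟩
    · exact (reForm_smul r x.1 u).symm ▸ mul_nonneg hr (h1 u)
    · exact (reForm_smul r x.2.1 u).symm ▸ mul_nonneg hr (h2 u)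
    · have := primalBlock_smul r x
      change 0 ≤ reForm (primalBlock (r • x)) z
      rw [this, reForm_smul]; exact mul_nonneg hr (h3 z)

/-- The linear constraints of the primal program. -/
def primalConstraint (L₁ L₂ : Module.End ℂ (Matrix N N ℂ)) (Ψ : Matrix N q ℂ) :
    PrimalSpace N q →ₗ[ℝ] Matrix N N ℂ × Matrix N N ℂ × Matrix q q ℂ where
  toFun x := (x.1 - L₁ x.1, x.2.1 - L₂ x.2.1, x.2.2.1 * Ψ - (x.2.2.1 * Ψ)ᴴ)
  map_add' x y := by
    simp only [Prod.fst_add, Prod.snd_add, map_add, Matrix.add_mul, Matrix.conjTranspose_add,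
      Prod.mk_add_mk, Prod.mk.injEq]
    refine ⟨?_, ?_, ?_⟩ <;> abel
  map_smul' r x := by
    simp only [Prod.smul_fst, Prod.smul_snd, LinearMap.map_smul_of_tower, Matrix.smul_mul,
      Matrix.conjTranspose_smul, star_trivial, RingHom.id_apply, Prod.smul_mk, smul_sub]

/-- The objective of the primal program. -/
def primalObjective (Θ : Matrix N q ℂ) : PrimalSpace N q →ₗ[ℝ] ℝ where
  toFun x := -x.2.2.2.trace.re - 4 * (Θ * x.2.2.1).trace.re
  map_add' x y := by
    simp only [Prod.snd_add, Prod.fst_add, Matrix.trace_add, Complex.add_re, Matrix.mul_add]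
    ring
  map_smul' r x := by
    simp only [Prod.smul_snd, Prod.smul_fst, Matrix.trace_smul, Complex.smul_re, Matrix.mul_smul,
      smul_eq_mul, RingHom.id_apply]
    ring

/-- The trace of `X₁ + X₂`. -/
def primalTrace : PrimalSpace N q →ₗ[ℝ] ℝ where
  toFun x := x.1.trace.re + x.2.1.trace.re
  map_add' x y := by
    simp only [Prod.snd_add, Prod.fst_add, Matrix.trace_add, Complex.add_re]
    ring
  map_smul' r x := by
    simp only [Prod.smul_snd, Prod.smul_fst, Matrix.trace_smul, Complex.smul_re,
      smul_eq_mul, RingHom.id_apply]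
    ring

theorem nonneg_of_forall_pos_add_mul_nonneg {a b : ℝ} (h : ∀ ε : ℝ, 0 < ε → 0 ≤ a + ε * b) :
    0 ≤ a := by
  refine ge_of_tendsto (x := nhdsWithin 0 (Set.Ioi 0)) (f := fun ε : ℝ => a + ε * b) ?_
    (Filter.eventually_of_mem self_mem_nhdsWithin h)
  have : Filter.Tendsto (fun ε : ℝ => a + ε * b) (nhds 0) (nhds (a + 0 * b)) := by
    apply Continuous.tendsto; fun_prop
  rw [zero_mul, add_zero] at this
  exact this.mono_left nhdsWithin_le_nhds

omit [DecidableEq N] [DecidableEq q] in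
theorem trace_fromBlocks (A : Matrix N N ℂ) (B : Matrix N q ℂ) (C : Matrix q N ℂ)
    (D : Matrix q q ℂ) : (Matrix.fromBlocks A B C D).trace = A.trace + D.trace := by
  simp [Matrix.trace]

/-- The functional given by the Riesz extension theorem. -/
theorem exists_dual_functional {L₁ L₂ : Module.End ℂ (Matrix N N ℂ)} (hL₁ : L₁ 1 = 1)
    (hL₂ : L₂ 1 = 1) (Ψ : Matrix N q ℂ) (f : PrimalSpace N q →ₗ[ℝ] ℝ)
    (hf : ∀ x ∈ primalCone N q, primalConstraint L₁ L₂ Ψ x = 0 → 0 ≤ f x) :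
    ∃ (Y₁ Y₂ : Matrix N N ℂ) (Y₃ : Matrix q q ℂ), ∀ x ∈ primalCone N q,
      0 ≤ f x + (Y₁ * (x.1 - L₁ x.1)).trace.re + (Y₂ * (x.2.1 - L₂ x.2.1)).trace.re +
        (Y₃ * (x.2.2.1 * Ψ - (x.2.2.1 * Ψ)ᴴ)).trace.re := by
  set Q := primalConstraint L₁ L₂ Ψ with hQ
  -- The functional is nonnegative on the part of the cone inside the kernel of the constraints. It
  -- extends to a functional nonnegative on the whole cone provided that every vector can be moved
  -- into the cone by an element of that kernel.
  obtain ⟨g, hg1, hg2⟩ := riesz_extension (primalCone N q)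
    ⟨LinearMap.ker Q, f ∘ₗ (LinearMap.ker Q).subtype⟩
    (fun x hx => hf x hx (LinearMap.mem_ker.mp x.2)) fun y => by
      obtain ⟨s1, -, h1⟩ := exists_re_dotProduct_smul_one_add_nonneg y.1
      obtain ⟨s2, -, h2⟩ := exists_re_dotProduct_smul_one_add_nonneg y.2.1
      obtain ⟨s3, hs3, h3⟩ := exists_re_dotProduct_smul_one_add_nonneg (primalBlock y)
      set r := max s1 (max s2 s3) with hr
      have hr3 : s3 ≤ 2 * r := by
        have : s3 ≤ r := (le_max_right _ _).trans (le_max_right _ _)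
        linarith
      -- Unitality of `L₁` and `L₂` puts this element in the kernel. The last entry is `2 r` to
      -- match `X₁ + X₂ = 2 r` in the other diagonal block.
      refine ⟨⟨((r : ℂ) • 1, (r : ℂ) • 1, 0, ((2 * r : ℝ) : ℂ) • 1), ?_⟩, ?_, ?_, ?_⟩
      · simp [hQ, primalConstraint, hL₁, hL₂]
      · exact h1 r (le_max_left _ _)
      · exact h2 r ((le_max_left _ _).trans (le_max_right _ _))
      · intro z
        rw [primalBlock_add]
        convert h3 (2 * r) hr3 z using 1
        rw [reForm]
        congr 4
        rw [primalBlock, ← Matrix.fromBlocks_one, Matrix.fromBlocks_smul, ← add_smul]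
        congr 1
        · congr 1; push_cast; ring
        · simp
        · simp
  -- The extension differs from `f` by a functional vanishing on the kernel of the constraints; it
  -- factors through them and supplies the multipliers.
  have hmem : g - f ∈ (LinearMap.ker Q).dualAnnihilator := by
    rw [Submodule.mem_dualAnnihilator]
    intro x hx
    have := hg1 ⟨x, hx⟩
    rw [LinearMap.sub_apply, sub_eq_zero]
    exact this
  rw [← LinearMap.range_dualMap_eq_dualAnnihilator_ker] at hmem
  obtain ⟨l, hl⟩ := hmem
  obtain ⟨Y₁, hY₁⟩ := exists_eq_re_trace_mul (l ∘ₗ LinearMap.inl ℝ _ _)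
  obtain ⟨Y₂, hY₂⟩ := exists_eq_re_trace_mul (l ∘ₗ LinearMap.inr ℝ _ _ ∘ₗ LinearMap.inl ℝ _ _)
  obtain ⟨Y₃, hY₃⟩ := exists_eq_re_trace_mul (l ∘ₗ LinearMap.inr ℝ _ _ ∘ₗ LinearMap.inr ℝ _ _)
  refine ⟨Y₁, Y₂, Y₃, fun x hx => ?_⟩
  have h1 := hg2 x hx
  have h2 : g x = f x + l (Q x) := by
    have := LinearMap.congr_fun hl x
    rw [LinearMap.dualMap_apply, LinearMap.sub_apply] at this
    linarith
  have h3 : l (Q x) = l ((Q x).1, 0, 0) + l (0, (Q x).2.1, 0) + l (0, 0, (Q x).2.2) := by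
    rw [← map_add, ← map_add]
    congr 1
    simp
  have h4 := hY₁ (Q x).1
  have h5 := hY₂ (Q x).2.1
  have h6 := hY₃ (Q x).2.2
  simp only [LinearMap.comp_apply, LinearMap.inl_apply, LinearMap.inr_apply] at h4 h5 h6
  have h7 : l ((Q x).1, 0, 0) = (Y₁ * (Q x).1).trace.re := h4
  rw [h2, h3, h7, h5, h6, ← add_assoc, ← add_assoc] at h1
  exact h1

/-- Strong duality with attainment of the dual optimum. -/
theorem exists_dual_feasible {L₁ L₂ : Module.End ℂ (Matrix N N ℂ)} (hL₁ : IsCausalProjection L₁)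
    (hL₂ : IsCausalProjection L₂) (Θ Ψ : Matrix N q ℂ) (c : ℝ)
    (hc : ∀ x ∈ primalCone N q, primalConstraint L₁ L₂ Ψ x = 0 →
      primalObjective Θ x ≤ c * primalTrace x) :
    ∃ (h : Matrix q q ℂ) (Y₁ Y₂ : Matrix N N ℂ), h.IsHermitian ∧ L₁ Y₁ = 0 ∧ L₂ Y₂ = 0 ∧
      (Matrix.fromBlocks ((c : ℂ) • 1 + Y₁) ((2 : ℂ) • (Θ - Complex.I • (Ψ * h)))
        ((2 : ℂ) • (Θ - Complex.I • (Ψ * h)))ᴴ 1).PosSemidef ∧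
      (Matrix.fromBlocks ((c : ℂ) • 1 + Y₂) ((2 : ℂ) • (Θ - Complex.I • (Ψ * h)))
        ((2 : ℂ) • (Θ - Complex.I • (Ψ * h)))ᴴ 1).PosSemidef := by
  obtain ⟨Y₁, Y₂, Y₃, hY⟩ := exists_dual_functional hL₁.map_one hL₂.map_one Ψ
    (c • primalTrace - primalObjective Θ) fun x hx hx0 => by
      simpa using hc x hx hx0
  -- Only the anti-Hermitian part of `Y₃` pairs with `B Ψ - (B Ψ)ᴴ`. The factor `i / 4` makes `h`
  -- Hermitian and cancels against the `-4 i` in the pairing.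
  set h : Matrix q q ℂ := (Complex.I / 4) • (Y₃ - Y₃ᴴ) with hh
  have hherm : h.IsHermitian := by
    rw [Matrix.IsHermitian, hh, Matrix.conjTranspose_smul, Matrix.conjTranspose_sub,
      Matrix.conjTranspose_conjTranspose, ← neg_sub Y₃, smul_neg, ← neg_smul]
    congr 1
    simp
    ring
  have hker : ∀ {L : Module.End ℂ (Matrix N N ℂ)}, IsCausalProjection L → ∀ Y,
      L (hermPart (Y - L Y)) = 0 := fun hL Y => by
    rw [hL.map_hermPart, map_sub, hL.idem, sub_self]; simp [hermPart]
  have htr : ∀ {L : Module.End ℂ (Matrix N N ℂ)}, IsCausalProjection L → ∀ Y u,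
      (Y * (Matrix.vecMulVec u (star u) - L (Matrix.vecMulVec u (star u)))).trace.re =
        reForm (hermPart (Y - L Y)) u := fun hL Y u => by
    rw [reForm_hermPart, reForm_eq_trace, Matrix.mul_sub, Matrix.sub_mul, Matrix.trace_sub,
      Matrix.trace_sub, hL.trace_mul]
  have hY3 : ∀ B : Matrix q N ℂ, (Y₃ * (B * Ψ - (B * Ψ)ᴴ)).trace.re =
      -4 * (Complex.I • (Ψ * h) * B).trace.re := fun B => by
    have e1 : (Y₃ * (B * Ψ)ᴴ).trace.re = (Y₃ᴴ * (B * Ψ)).trace.re := by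
      rw [← re_trace_conjTranspose, Matrix.conjTranspose_mul, Matrix.conjTranspose_conjTranspose,
        Matrix.trace_mul_comm]
    have e2 : (Complex.I • (Ψ * h) * B).trace = (-1 / 4 : ℝ) • ((Y₃ - Y₃ᴴ) * (B * Ψ)).trace := by
      rw [hh, Matrix.mul_smul, smul_smul, Matrix.smul_mul, Matrix.trace_smul, Matrix.mul_assoc,
        Matrix.trace_mul_comm, Matrix.mul_assoc, ← mul_div_assoc, Complex.I_mul_I,
        Complex.real_smul]
      push_cast
      rfl
    rw [e2, Complex.smul_re, Matrix.mul_sub, Matrix.trace_sub, Complex.sub_re, e1, Matrix.sub_mul,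
      Matrix.trace_sub, Complex.sub_re, smul_eq_mul]
    ring
  have hblock : ∀ Y : Matrix N N ℂ, Y.IsHermitian →
      (∀ (u : N → ℂ) (w : q → ℂ), 0 ≤ c * (Matrix.vecMulVec u (star u)).trace.re +
        (Matrix.vecMulVec w (star w)).trace.re +
        4 * ((Θ - Complex.I • (Ψ * h)) * Matrix.vecMulVec w (star u)).trace.re + reForm Y u) →
      (Matrix.fromBlocks ((c : ℂ) • 1 + Y) ((2 : ℂ) • (Θ - Complex.I • (Ψ * h)))
        ((2 : ℂ) • (Θ - Complex.I • (Ψ * h)))ᴴ 1).PosSemidef := by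
    intro Y hYh hpos
    refine posSemidef_of_reForm_nonneg ?_ fun z => ?_
    · rw [Matrix.isHermitian_fromBlocks_iff]
      refine ⟨?_, rfl, Matrix.conjTranspose_conjTranspose _, Matrix.isHermitian_one⟩
      refine Matrix.IsHermitian.add ?_ hYh
      rw [Matrix.IsHermitian, Matrix.conjTranspose_smul, Matrix.conjTranspose_one]
      simp
    · obtain ⟨u, w, rfl⟩ : ∃ u w, z = Sum.elim u w :=
        ⟨z ∘ Sum.inl, z ∘ Sum.inr, (Sum.elim_comp_inl_inr z).symm⟩
      have e : Matrix.vecMulVec (Sum.elim u w) (star (Sum.elim u w)) =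
          Matrix.fromBlocks (Matrix.vecMulVec u (star u)) (Matrix.vecMulVec u (star w))
            (Matrix.vecMulVec w (star u)) (Matrix.vecMulVec w (star w)) := by
        ext i j
        rcases i with i | i <;> rcases j with j | j <;> simp [Matrix.vecMulVec_apply]
      set gp := Θ - Complex.I • (Ψ * h)
      have e2 : (gpᴴ * Matrix.vecMulVec u (star w)).trace.re =
          (gp * Matrix.vecMulVec w (star u)).trace.re := by
        rw [← re_trace_conjTranspose, Matrix.conjTranspose_mul, Matrix.conjTranspose_conjTranspose,
          Matrix.conjTranspose_vecMulVec, star_star, Matrix.trace_mul_comm]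
      have := hpos u w
      rw [reForm_eq_trace] at this
      simp only [Matrix.trace_vecMulVec] at this
      rw [reForm_eq_trace, e, Matrix.fromBlocks_multiply, trace_fromBlocks]
      simp only [Matrix.add_mul, Matrix.trace_add, Complex.add_re, Matrix.smul_mul, Matrix.one_mul,
        Matrix.trace_smul, smul_eq_mul, Matrix.conjTranspose_smul, Complex.mul_re]
      simp
      rw [e2]
      linarith
  have hrank : ∀ (u : N → ℂ) (w : q → ℂ), ∀ z, 0 ≤ reForm (Matrix.fromBlocks
      (Matrix.vecMulVec u (star u)) (Matrix.vecMulVec w (star u))ᴴ (Matrix.vecMulVec w (star u))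
      (Matrix.vecMulVec w (star w))) z := by
    intro u w
    refine reForm_nonneg ?_
    have e : Matrix.vecMulVec (Sum.elim u w) (star (Sum.elim u w)) =
          Matrix.fromBlocks (Matrix.vecMulVec u (star u)) (Matrix.vecMulVec w (star u))ᴴ
            (Matrix.vecMulVec w (star u)) (Matrix.vecMulVec w (star w)) := by
      ext i j
      rcases i with i | i <;> rcases j with j | j <;> simp [Matrix.vecMulVec_apply]
    rw [← e]
    exact Matrix.posSemidef_vecMulVec_self_star _
  refine ⟨h, hermPart (Y₁ - L₁ Y₁), hermPart (Y₂ - L₂ Y₂), hherm, hker hL₁ _, hker hL₂ _,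
    hblock _ (isHermitian_hermPart _) fun u w => ?_,
    hblock _ (isHermitian_hermPart _) fun u w => ?_⟩
  -- A rank-one block built from `(u, w)`, placed entirely in the first strategy, turns the
  -- functional inequality into the quadratic form of the first dual block matrix. The second case
  -- puts it in the second strategy.
  · have := hY (Matrix.vecMulVec u (star u), 0, Matrix.vecMulVec w (star u),
      Matrix.vecMulVec w (star w)) ⟨reForm_nonneg (Matrix.posSemidef_vecMulVec_self_star u),
        fun _ => by simp [reForm], by simpa [primalBlock] using hrank u w⟩
    simp only [hY3, htr hL₁] at this
    simp [primalTrace, primalObjective] at this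
    rw [Matrix.sub_mul, Matrix.trace_sub, Complex.sub_re]
    simp
    linarith
  · have := hY (0, Matrix.vecMulVec u (star u), Matrix.vecMulVec w (star u),
      Matrix.vecMulVec w (star w)) ⟨fun _ => by simp [reForm],
        reForm_nonneg (Matrix.posSemidef_vecMulVec_self_star u),
        by simpa [primalBlock] using hrank u w⟩
    simp only [hY3, htr hL₂] at this
    simp [primalTrace, primalObjective] at this
    rw [Matrix.sub_mul, Matrix.trace_sub, Complex.sub_re]
    simp
    linarith

end Duality

/-! ### Compactness of the set of reduced strategies -/

section Compactness

variable {n : Type*} [Fintype n]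

theorem continuous_reForm (u : n → ℂ) : Continuous fun M : Matrix n n ℂ => reForm M u :=
  Complex.continuous_re.comp (by fun_prop)

theorem posSemidef_iff_reForm {M : Matrix n n ℂ} :
    M.PosSemidef ↔ M.IsHermitian ∧ ∀ u, 0 ≤ reForm M u :=
  ⟨fun h => ⟨h.1, reForm_nonneg h⟩, fun h => posSemidef_of_reForm_nonneg h.1 h.2⟩

theorem isClosed_posSemidef : IsClosed {M : Matrix n n ℂ | M.PosSemidef} := by
  simp only [posSemidef_iff_reForm, Set.ofPred_and, Set.ofPred_forall]
  refine IsClosed.inter ?_ (isClosed_iInter fun u => isClosed_le continuous_const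
    (continuous_reForm u))
  exact isClosed_eq continuous_id.matrix_conjTranspose continuous_id

omit [Fintype n] in
theorem isCompact_norm_apply_le (r : ℝ) : IsCompact {M : Matrix n n ℂ | ∀ a b, ‖M a b‖ ≤ r} := by
  have h : IsCompact (Set.pi Set.univ fun _ : n => Set.pi Set.univ fun _ : n =>
      Metric.closedBall (0 : ℂ) r) :=
    isCompact_univ_pi fun _ => isCompact_univ_pi fun _ => isCompact_closedBall _ _
  have e : (Set.pi Set.univ fun _ : n => Set.pi Set.univ fun _ : n =>
      Metric.closedBall (0 : ℂ) r) = {M : n → n → ℂ | ∀ a b, ‖M a b‖ ≤ r} := by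
    ext M
    simp
  rw [e] at h
  exact h

variable {I O : Type*} [Fintype I] [DecidableEq I] [Nonempty I] [Fintype O] [DecidableEq O]
  [Nonempty O]

/-- The set is the image under addition of a closed set of pairs, and the common trace constraint
bounds all entries of both positive operators. -/
theorem isCompact_redStrategies : IsCompact (redStrategies I O) := by
  set S : Set (Matrix (Sys I O) (Sys I O) ℂ × Matrix (Sys I O) (Sys I O) ℂ) :=
    {x | x.1.PosSemidef ∧ x.2.PosSemidef ∧ Lam₁₂ x.1 = x.1 ∧ Lam₂₁ x.2 = x.2 ∧
        x.1.trace + x.2.trace = (Fintype.card O : ℂ) ^ 2} with hS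
  have himage : redStrategies I O = (fun x => x.1 + x.2) '' S := by
    ext X
    rw [mem_redStrategies_iff]
    constructor
    · rintro ⟨X₁, X₂, h1, h2, h3, h4, h5, rfl⟩
      exact ⟨(X₁, X₂), ⟨h1, h2, h3, h4, h5⟩, rfl⟩
    · rintro ⟨⟨X₁, X₂⟩, ⟨h1, h2, h3, h4, h5⟩, rfl⟩
      exact ⟨X₁, X₂, h1, h2, h3, h4, h5, rfl⟩
  have hclosed : IsClosed S := by
    have c1 : Continuous (lam₁₂ I O) := LinearMap.continuous_of_finiteDimensional _
    have c2 : Continuous (lam₂₁ I O) := LinearMap.continuous_of_finiteDimensional _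
    refine (isClosed_posSemidef.preimage continuous_fst).inter
      ((isClosed_posSemidef.preimage continuous_snd).inter ((isClosed_eq
        (c1.comp continuous_fst) continuous_fst).inter ((isClosed_eq
          (c2.comp continuous_snd) continuous_snd).inter (isClosed_eq ?_ continuous_const))))
    exact continuous_fst.matrix_trace.add continuous_snd.matrix_trace
  rw [himage]
  refine IsCompact.image ?_ (continuous_fst.add continuous_snd)
  refine ((isCompact_norm_apply_le ((Fintype.card O : ℝ) ^ 2)).prod
    (isCompact_norm_apply_le ((Fintype.card O : ℝ) ^ 2))).of_isClosed_subset hclosed ?_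
  rintro ⟨X₁, X₂⟩ ⟨h1, h2, -, -, h5⟩
  have e : X₁.trace.re + X₂.trace.re = (Fintype.card O : ℝ) ^ 2 := by
    have := congrArg Complex.re h5
    rw [Complex.add_re] at this
    rw [this]
    norm_cast
  have p1 := (Complex.le_def.mp h1.trace_nonneg).1
  have p2 := (Complex.le_def.mp h2.trace_nonneg).1
  rw [Complex.zero_re] at p1 p2
  exact ⟨fun a b => (norm_apply_le_trace h1 a b).trans (by linarith),
    fun a b => (norm_apply_le_trace h2 a b).trans (by linarith)⟩

end Compactness

/-! ### Weak duality -/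

section WeakDuality

variable {I O : Type*} [Fintype I] [DecidableEq I] [Nonempty I] [Fintype O] [DecidableEq O]
  [Nonempty O] {q : ℕ} {H : Matrix (Sys I O) (Sys I O) ℂ} {Φ : Matrix (Sys I O) (Fin q) ℂ}

-- The primal block matrix is paired with the Gram matrix of the rows `2 g` and `1`, where `g` is
-- the gap. Hermiticity of `B Φ*` makes `tr (h B Φ*)` real, so `h` disappears from the real part of
-- the cross term.
omit [DecidableEq I] [DecidableEq O] [Nonempty I] [Nonempty O] in
theorem primal_le_trace_mul_Omega {X : Matrix (Sys I O) (Sys I O) ℂ}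
    {B : Matrix (Fin q) (Sys I O) ℂ} {C h : Matrix (Fin q) (Fin q) ℂ}
    (hX : (Matrix.fromBlocks X Bᴴ B C).PosSemidef) (hB : (B * conj Φ).IsHermitian)
    (hh : h.IsHermitian) :
    -C.trace.re - 4 * (conj H * conj Φ * B).trace.re ≤ (X * Omega H Φ h).trace.re := by
  set g := gap H Φ h with hg
  have hW : (Matrix.fromBlocks ((4 : ℂ) • (g * gᴴ)) ((2 : ℂ) • g) ((2 : ℂ) • gᴴ) 1).PosSemidef := by
    have := Matrix.posSemidef_self_mul_conjTranspose
      (Matrix.fromRows ((2 : ℂ) • g) (1 : Matrix (Fin q) (Fin q) ℂ))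
    rw [Matrix.conjTranspose_fromRows_eq_fromCols_conjTranspose, Matrix.fromRows_mul_fromCols]
      at this
    convert this using 2
    · rw [Matrix.conjTranspose_smul, Matrix.smul_mul, Matrix.mul_smul, smul_smul]
      norm_num
    · simp
    · simp
    · simp
  have h1 := trace_mul_re_nonneg hX hW
  rw [Matrix.fromBlocks_multiply, trace_fromBlocks] at h1
  have e1 : (Bᴴ * gᴴ).trace.re = (g * B).trace.re := by
    rw [← Matrix.conjTranspose_mul, re_trace_conjTranspose]
  have e2 : (B * g).trace.re = (g * B).trace.re := by rw [Matrix.trace_mul_comm]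
  have e3 : (g * B).trace.re = (conj H * conj Φ * B).trace.re := by
    have e : (Complex.I • (conj Φ * h) * B).trace = Complex.I * (h * (B * conj Φ)).trace := by
      rw [Matrix.smul_mul, Matrix.trace_smul, smul_eq_mul, Matrix.mul_assoc, Matrix.trace_mul_comm,
        Matrix.mul_assoc]
    rw [hg, gap, Matrix.sub_mul, Matrix.trace_sub, Complex.sub_re, e, Complex.I_mul_re,
      im_trace_mul_eq_zero hh hB, neg_zero, sub_zero]
  have e4 : X * Omega H Φ h = X * ((4 : ℂ) • (g * gᴴ)) := rfl
  rw [← e4] at h1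
  simp only [Matrix.trace_add, Complex.add_re, Matrix.mul_smul, Matrix.mul_one, Matrix.trace_smul,
    smul_eq_mul, Complex.mul_re, Complex.re_ofNat, Complex.im_ofNat, zero_mul,
    sub_zero, e1, e2, e3] at h1
  linarith

-- The dual block matrix is paired with the congruence of `X` by the rows `1` and `-gᴴ`, with `g`
-- twice the gap, a Schur complement in trace form. The slack `Y` drops out since `tr (Y X) = tr (Y
-- (L X)) = tr ((L Y) X) = 0`.
omit [Nonempty I] [Nonempty O] in
theorem trace_mul_Omega_le {L : Module.End ℂ (Matrix (Sys I O) (Sys I O) ℂ)}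
    (hL : IsCausalProjection L) {X Y : Matrix (Sys I O) (Sys I O) ℂ} (hX : X.PosSemidef)
    (hLX : L X = X) (hLY : L Y = 0) {c : ℝ} {h : Matrix (Fin q) (Fin q) ℂ}
    (hY : (Matrix.fromBlocks ((c : ℂ) • 1 + Y) ((2 : ℂ) • gap H Φ h) ((2 : ℂ) • gap H Φ h)ᴴ
      1).PosSemidef) :
    (X * Omega H Φ h).trace.re ≤ c * X.trace.re := by
  have eO : Omega H Φ h = ((2 : ℂ) • gap H Φ h) * ((2 : ℂ) • gap H Φ h)ᴴ := by
    rw [Omega, Matrix.conjTranspose_smul, Matrix.smul_mul, Matrix.mul_smul, smul_smul]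
    norm_num
  rw [eO]
  generalize (2 : ℂ) • gap H Φ h = g at hY
  have hW := hX.mul_mul_conjTranspose_same
    (Matrix.fromRows (1 : Matrix (Sys I O) (Sys I O) ℂ) (-gᴴ))
  rw [Matrix.conjTranspose_fromRows_eq_fromCols_conjTranspose, Matrix.fromRows_mul,
    Matrix.fromRows_mul_fromCols] at hW
  have h1 := trace_mul_re_nonneg hY hW
  rw [Matrix.fromBlocks_multiply, trace_fromBlocks] at h1
  have hYX : (Y * X).trace = 0 := by
    rw [← hLX, ← hL.trace_mul, hLY, Matrix.zero_mul, Matrix.trace_zero]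
  have e1 : (X * (g * gᴴ)).trace = (g * (gᴴ * X)).trace := by
    rw [Matrix.trace_mul_comm, Matrix.mul_assoc]
  simp only [Matrix.conjTranspose_one, Matrix.conjTranspose_neg, Matrix.conjTranspose_conjTranspose,
    Matrix.one_mul, Matrix.mul_one, Matrix.neg_mul, Matrix.mul_neg, neg_neg, Matrix.add_mul,
    Matrix.trace_add, Matrix.trace_neg, hYX, Matrix.smul_mul, Matrix.trace_smul, smul_eq_mul,
    add_zero, Matrix.mul_assoc, neg_add_cancel, Complex.add_re, Complex.neg_re,
    Complex.re_ofReal_mul, Matrix.trace_zero] at h1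
  rw [e1]
  linarith

end WeakDuality

/-! ### Strong duality -/

section StrongDuality

variable {I O : Type*} [Fintype I] [DecidableEq I] [Nonempty I] [Fintype O] [DecidableEq O]
  [Nonempty O] {q : ℕ} {H : Matrix (Sys I O) (Sys I O) ℂ} {Φ : Matrix (Sys I O) (Fin q) ℂ}

/-- By homogeneity, the Hermitian part of `x`, rescaled to trace `d_O`, is a primal feasible point.
Passing to Hermitian parts changes neither the objective nor the trace, and the causal maps commute
with it; `B` itself is only rescaled. -/
theorem primalObjective_le_of_primalTrace_pos {v : ℝ} (hv : ∀ w ∈ primalValues H Φ, w ≤ v)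
    {x : PrimalSpace (Sys I O) (Fin q)} (hx : x ∈ primalCone (Sys I O) (Fin q))
    (hx0 : primalConstraint (lam₁₂ I O) (lam₂₁ I O) (conj Φ) x = 0) (ht : 0 < primalTrace x) :
    primalObjective (conj H * conj Φ) x ≤ v / (Fintype.card O : ℝ) ^ 2 * primalTrace x := by
  obtain ⟨X₁, X₂, B, C⟩ := x
  obtain ⟨h1, h2, h3⟩ := hx
  simp only [primalConstraint, LinearMap.coe_mk, AddHom.coe_mk, Prod.mk_eq_zero, sub_eq_zero]
    at hx0
  obtain ⟨e1, e2, e3⟩ := hx0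
  have hO : (0 : ℝ) < (Fintype.card O : ℝ) ^ 2 := by positivity
  set τ := primalTrace (X₁, X₂, B, C) with hτ
  set s := (Fintype.card O : ℝ) ^ 2 / τ with hs
  have hs0 : 0 < s := div_pos hO ht
  have hreal : ∀ M : Matrix (Sys I O) (Sys I O) ℂ,
      (hermPart M).trace = (M.trace.re : ℂ) := fun M => by
    refine Complex.ext (by rw [re_trace_hermPart, Complex.ofReal_re]) ?_
    have := im_trace_mul_eq_zero (isHermitian_hermPart M) Matrix.isHermitian_one
    rwa [mul_one] at this
  have hblock : Matrix.fromBlocks (s • hermPart X₁ + s • hermPart X₂) (s • B)ᴴ (s • B)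
      (s • hermPart C) = s • hermPart (primalBlock (X₁, X₂, B, C)) := by
    simp only [hermPart, primalBlock, Matrix.fromBlocks_conjTranspose, Matrix.fromBlocks_add,
      Matrix.fromBlocks_smul, Matrix.conjTranspose_smul, Matrix.conjTranspose_conjTranspose,
      star_trivial, ← two_smul ℝ B, ← two_smul ℝ Bᴴ, smul_smul, Matrix.conjTranspose_add]
    congr 1
    · rw [← smul_add]
      congr 1
      abel
    · norm_num
    · norm_num
  have key := hv (-(s • hermPart C).trace.re - 4 * (conj H * conj Φ * (s • B)).trace.re)
    ⟨s • hermPart X₁, s • hermPart X₂, s • B, s • hermPart C,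
      (posSemidef_hermPart h1).smul hs0.le, (posSemidef_hermPart h2).smul hs0.le, ?_, ?_, ?_, ?_, ?_,
      rfl⟩
  · have e : -(s • hermPart C).trace.re - 4 * (conj H * conj Φ * (s • B)).trace.re =
        s * primalObjective (conj H * conj Φ) (X₁, X₂, B, C) := by
      simp only [primalObjective, LinearMap.coe_mk, AddHom.coe_mk, Matrix.trace_smul,
        Matrix.mul_smul, Complex.smul_re, re_trace_hermPart, smul_eq_mul]
      ring
    rw [e, hs, div_mul_eq_mul_div, div_le_iff₀ ht] at key
    rw [div_mul_eq_mul_div, le_div_iff₀ hO]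
    linarith
  · rw [Lam₁₂_eq, LinearMap.map_smul_of_tower, isCausalProjection_lam₁₂.map_hermPart, ← e1]
  · rw [Lam₂₁_eq, LinearMap.map_smul_of_tower, isCausalProjection_lam₂₁.map_hermPart, ← e2]
  · rw [Matrix.trace_smul, Matrix.trace_smul, hreal, hreal, Complex.real_smul, Complex.real_smul]
    have : s * X₁.trace.re + s * X₂.trace.re = (Fintype.card O : ℝ) ^ 2 := by
      rw [← mul_add, hs]
      exact div_mul_cancel₀ _ ht.ne'
    exact_mod_cast congrArg (fun r : ℝ => (r : ℂ)) this
  · rw [hblock]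
    exact (posSemidef_hermPart h3).smul hs0.le
  · rw [Matrix.smul_mul, Matrix.IsHermitian, Matrix.conjTranspose_smul, star_trivial, ← e3]

/-- Vectors of trace zero cannot be normalized, so `x` is perturbed by a small multiple of `x₀`,
which satisfies the constraints and has positive trace, and the multiple is sent to zero. -/
theorem primalObjective_le {v : ℝ} (hv : ∀ w ∈ primalValues H Φ, w ≤ v)
    {x : PrimalSpace (Sys I O) (Fin q)} (hx : x ∈ primalCone (Sys I O) (Fin q))
    (hx0 : primalConstraint (lam₁₂ I O) (lam₂₁ I O) (conj Φ) x = 0) :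
    primalObjective (conj H * conj Φ) x ≤ v / (Fintype.card O : ℝ) ^ 2 * primalTrace x := by
  set x₀ : PrimalSpace (Sys I O) (Fin q) := (1, 1, 0, 1) with hx₀
  have hc : x₀ ∈ primalCone (Sys I O) (Fin q) := by
    refine ⟨reForm_nonneg .one, reForm_nonneg .one, reForm_nonneg ?_⟩
    have : primalBlock x₀ = Matrix.diagonal (Sum.elim (fun _ : Sys I O => (2 : ℂ)) fun _ => 1) := by
      ext i j
      rcases i with i | i <;> rcases j with j | j <;>
        simp [primalBlock, hx₀, Matrix.diagonal_apply, Matrix.one_apply]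
      split_ifs <;> norm_num
    rw [this]
    refine Matrix.PosSemidef.diagonal fun i => ?_
    rcases i with i | i <;> simp
  have hc0 : primalConstraint (lam₁₂ I O) (lam₂₁ I O) (conj Φ) x₀ = 0 := by
    simp [primalConstraint, hx₀, isCausalProjection_lam₁₂.map_one,
      isCausalProjection_lam₂₁.map_one]
  have ht0 : 0 < primalTrace x₀ := by
    simp only [primalTrace, hx₀, LinearMap.coe_mk, AddHom.coe_mk, Matrix.trace_one]
    rw [Complex.natCast_re]
    positivity
  have ht : 0 ≤ primalTrace x := by
    have e1 := (Complex.le_def.mp (posSemidef_hermPart hx.1).trace_nonneg).1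
    have e2 := (Complex.le_def.mp (posSemidef_hermPart hx.2.1).trace_nonneg).1
    rw [re_trace_hermPart, Complex.zero_re] at e1 e2
    exact add_nonneg e1 e2
  rw [← sub_nonneg]
  refine nonneg_of_forall_pos_add_mul_nonneg
    (b := v / (Fintype.card O : ℝ) ^ 2 * primalTrace x₀ -
      primalObjective (conj H * conj Φ) x₀) fun ε hε => ?_
  have hmem : x + ε • x₀ ∈ primalCone (Sys I O) (Fin q) :=
    add_mem hx ((primalCone (Sys I O) (Fin q)).smul_mem hε.le hc)
  have key := primalObjective_le_of_primalTrace_pos hv hmem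
    (by rw [map_add, map_smul, hx0, hc0, smul_zero, add_zero])
    (by rw [map_add, map_smul, smul_eq_mul]; positivity)
  simp only [map_add, map_smul, smul_eq_mul] at key
  linarith

theorem mem_dualValues {v : ℝ} (hv : ∀ w ∈ primalValues H Φ, w ≤ v) : v ∈ dualValues H Φ := by
  obtain ⟨h, Y₁, Y₂, hh, h1, h2, h3, h4⟩ := exists_dual_feasible isCausalProjection_lam₁₂
    isCausalProjection_lam₂₁ (conj H * conj Φ) (conj Φ) (v / (Fintype.card O : ℝ) ^ 2)
    fun x hx hx0 => primalObjective_le hv hx hx0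
  push_cast at h3 h4
  exact ⟨h, Y₁, Y₂, hh, h1, h2, h3, h4⟩

end StrongDuality

end GlobalEst

/-! ### The main theorem -/

theorem mainTheorem6 {I O : Type*} [Fintype I] [DecidableEq I] [Nonempty I]
    [Fintype O] [DecidableEq O] [Nonempty O]
    (p : MeasureTheory.Measure ℝ) [MeasureTheory.IsProbabilityMeasure p]
    (hp : MeasureTheory.Integrable (fun θ : ℝ => θ) p)
    (E : ℝ → Matrix I I ℂ →ₗ[ℂ] Matrix O O ℂ)
    (hE : ∀ θ, GlobalEst.IsChannel (E θ))
    (hEm : ∀ (ρ : Matrix I I ℂ) (a b : O), AEMeasurable (fun θ => E θ ρ a b) p)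
    (H : Matrix (GlobalEst.Sys I O) (GlobalEst.Sys I O) ℂ) (hH : H.IsHermitian)
    (hHC : -(H * GlobalEst.meanChoi p E + GlobalEst.meanChoi p E * H) =
      GlobalEst.meanThetaChoi p E)
    (q : ℕ) (Φ : Matrix (GlobalEst.Sys I O) (Fin q) ℂ)
    (hΦ : Φ * Φᴴ = GlobalEst.meanChoi p E) :
    IsGreatest (GlobalEst.informationValues p E) (GlobalEst.Jmax p E) ∧
    IsGreatest (GlobalEst.maxMinValues H Φ) (GlobalEst.Jmax p E) ∧
    IsGreatest (GlobalEst.primalValues H Φ) (GlobalEst.Jmax p E) ∧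
    IsLeast (GlobalEst.dualValues H Φ) (GlobalEst.Jmax p E) := by
  open GlobalEst in
  obtain ⟨G, hG⟩ := exists_mul_eq_mul hp hE hEm hH hHC hΦ
  have hIP := informationValues_subset_primalValues hp hE hEm hH hHC hΦ
  have hMI := maxMinValues_subset_informationValues hp hE hEm hH hHC hΦ hG
  have hps : ∀ X ∈ redStrategies I O, X.PosSemidef := fun X hX => by
    obtain ⟨X₁, X₂, h1, h2, -, -, -, rfl⟩ := mem_redStrategies_iff.mp hX
    exact h1.add h2
  set f : Matrix (Sys I O) (Sys I O) ℂ → ℝ := fun X =>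
    ⨅ h : {h : Matrix (Fin q) (Fin q) ℂ // h.IsHermitian}, (X * Omega H Φ h).trace.re with hf
  have hrange : ∀ X, Set.range (fun h : {h : Matrix (Fin q) (Fin q) ℂ // h.IsHermitian} =>
      (X * Omega H Φ h).trace.re) = {w | ∃ h : Matrix (Fin q) (Fin q) ℂ, h.IsHermitian ∧
      w = (X * Omega H Φ h).trace.re} := fun X => by
    ext w
    simp [eq_comm]
  have hleast : ∀ X ∈ redStrategies I O, IsLeast {w | ∃ h : Matrix (Fin q) (Fin q) ℂ,
      h.IsHermitian ∧ w = (X * Omega H Φ h).trace.re} (f X) := fun X hX => by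
    obtain ⟨w, hw⟩ := exists_isLeast_trace_mul_Omega hG (hps X hX)
    have : f X = w := by
      change sInf (Set.range _) = w
      rw [hrange, hw.csInf_eq]
    rwa [this]
  -- An infimum of continuous functions of `X` is upper semicontinuous. It must be bounded below
  -- pointwise, which holds because the minimum over `h` is attained.
  have husc : UpperSemicontinuousOn f (redStrategies I O) := by
    refine upperSemicontinuousOn_ciInf (fun X hX => ?_) fun h => ?_
    · rw [hrange]
      exact (hleast X hX).bddBelow
    · refine Continuous.upperSemicontinuous ?_ |>.upperSemicontinuousOn _
      exact Complex.continuous_re.comp (continuous_id.matrix_mul continuous_const).matrix_trace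
  have hne : (redStrategies I O).Nonempty := by
    obtain ⟨Z, hZ1, hZ2⟩ := exists_mem_seq₁₂_inter_seq₂₁ (I := I) (O := O)
    exact ⟨Z, 1, zero_le_one, le_rfl, Z, hZ1, Z, hZ2, by simp⟩
  obtain ⟨X, hX, hmax⟩ := husc.exists_isMaxOn hne isCompact_redStrategies
  have hM : f X ∈ maxMinValues H Φ := ⟨X, hX, hleast X hX⟩
  have hP : ∀ w ∈ primalValues H Φ, w ≤ f X := by
    rintro w ⟨X₁, X₂, B, C, h1, h2, h3, h4, h5, h6, h7, rfl⟩
    have hX' : X₁ + X₂ ∈ redStrategies I O :=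
      mem_redStrategies_iff.mpr ⟨X₁, X₂, h1, h2, h3, h4, h5, rfl⟩
    -- The `h` optimal for this particular `X₁ + X₂` is used, so weak duality bounds the primal
    -- value by `f (X₁ + X₂)`.
    obtain ⟨h, hh, e⟩ := (hleast _ hX').1
    exact (primal_le_trace_mul_Omega h6 h7 hh).trans (e ▸ hmax hX')
  have hJ : Jmax p E = f X :=
    (show IsGreatest (informationValues p E) (f X) from
      ⟨hMI hM, fun w hw => hP w (hIP hw)⟩).csSup_eq
  rw [hJ]
  refine ⟨⟨hMI hM, fun w hw => hP w (hIP hw)⟩, ⟨hM, fun w hw => hP w (hIP (hMI hw))⟩,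
    ⟨hIP (hMI hM), hP⟩, mem_dualValues hP, ?_⟩
  -- The optimal `X` splits into its two causal components. Each is bounded using its own dual
  -- block, and the bounds add up to `l` because the two traces sum to `d_O`.
  rintro l ⟨h, Y₁, Y₂, hh, hY₁, hY₂, hb₁, hb₂⟩
  obtain ⟨X₁, X₂, h1, h2, h3, h4, h5, rfl⟩ := mem_redStrategies_iff.mp hX
  have hO : (0 : ℝ) < (Fintype.card O : ℝ) ^ 2 := by positivity
  have hc : (l : ℂ) / (Fintype.card O : ℂ) ^ 2 = ((l / (Fintype.card O : ℝ) ^ 2 : ℝ) : ℂ) := by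
    push_cast; rfl
  rw [hc] at hb₁ hb₂
  have e1 := trace_mul_Omega_le isCausalProjection_lam₁₂ h1 h3 hY₁ hb₁
  have e2 := trace_mul_Omega_le isCausalProjection_lam₂₁ h2 h4 hY₂ hb₂
  have e3 := (hleast _ hX).2 ⟨h, hh, rfl⟩
  have e4 : X₁.trace.re + X₂.trace.re = (Fintype.card O : ℝ) ^ 2 := by
    rw [← Complex.add_re, h5]
    norm_cast
  rw [Matrix.add_mul, Matrix.trace_add, Complex.add_re] at e3
  have e5 : l / (Fintype.card O : ℝ) ^ 2 * X₁.trace.re + l / (Fintype.card O : ℝ) ^ 2 * X₂.trace.re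
      = l := by
    rw [← mul_add, e4, div_mul_cancel₀ _ hO.ne']
  linarith
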